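/- Let $m,n\ge 0$ be integers, let $\mathcal U$ be a nonprincipal ultrafilter on a set $\mathbb I$, and for each $r\in\mathbb I$ let $K_r$ be a field of characteristic zero equipped with $m$ commuting derivations $\Delta=\{\delta_1,\dots,\delta_m\}$. For a $\Delta$-field $k$, let $k\{X\}$ denote the ring of $\Delta$-polynomials over $k$ in $X=(X_1,\dots,X_n)$, that is, the polynomial ring over $k$ in the algebraic indeterminates $\delta_1^{e_1}\cdots\delta_m^{e_m}X_j$ ($e_1,\dots,e_m\ge 0$, $1\le j\le n$), with its natural $\Delta$-ring structure. Let $K=\prod_{\mathcal U}K_r$, with its coordinatewise $\Delta$-field structure, and let $K\{X\}_{\mathrm{int}}=\prod_{\mathcal U}\bigl(K_r\{X\}\bigr)$ be the ring of internal $\Delta$-polynomials. Regard $K\{X\}_{\mathrm{int}}$ as an extension of $K\{X\}$ through the embedding that sends a finite sum $\sum_M a_M M$ ($a_M\in K$, $M$ monomials in the algebraic indeterminates) to the class of the sequence $\bigl(\sum_M a_M(r)M\bigr)_{r\in\mathbb I}$. Let $\mathbb N^*=\prod_{\mathcal U}\mathbb N$, and for $g\in K\{X\}_{\mathrm{int}}$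 and $N\in\mathbb N^*$ let $g^N\in K\{X\}_{\mathrm{int}}$ be the element with coordinates $g(r)^{N(r)}$. Then $K\{X\}_{\mathrm{int}}$ is a faithfully flat $K\{X\}$-module. Moreover, for any ideal $I$ of $K\{X\}$, (a) $I$ is prime in $K\{X\}$ if and only if $I\,K\{X\}_{\mathrm{int}}$ is prime in $K\{X\}_{\mathrm{int}}$, and (b) $\{g\in K\{X\} : g^N\in I\,K\{X\}_{\mathrm{int}}\text{ for some }N\in\mathbb N^*\}=\sqrt I$. -/

import Mathlib

noncomputable section

namespace DeltaAlg

/-- A `Δ`-ring structure, `Δ = {δ₁, …, δₘ}`, on a commutative ring: `m` pairwise commuting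
derivations. A `Δ`-field is a field with such a structure. -/
class DeltaRing (m : ℕ) (R : Type*) [CommRing R] where
  /-- the derivations -/
  δ : Fin m → Derivation ℤ R R
  δ_comm : ∀ i j a, δ i (δ j a) = δ j (δ i a)

/-! ### Ultraproducts of rings

`Filter.Product U R` is the set of sequences `a : ∀ r, R r`, two sequences being identified when
they agree `U`-almost everywhere. We equip it with its coordinatewise structure. -/

section Ultraproduct

variable {𝕀 : Type*} (U : Ultrafilter 𝕀)

/-- Equality `U`-almost everywhere, as a congruence on the ring of all sequences. -/
def ultraCon (R : 𝕀 → Type*) [∀ r, CommRing (R r)] : RingCon (∀ r, R r) where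
  toSetoid := Filter.productSetoid (U : Filter 𝕀) R
  mul' h₁ h₂ := by
    filter_upwards [h₁, h₂] with r e₁ e₂
    simp [e₁, e₂]
  add' h₁ h₂ := by
    filter_upwards [h₁, h₂] with r e₁ e₂
    simp [e₁, e₂]

/-- The coordinatewise ring structure on an ultraproduct of rings. -/
instance (R : 𝕀 → Type*) [∀ r, CommRing (R r)] : CommRing ((U : Filter 𝕀).Product R) :=
  inferInstanceAs (CommRing (ultraCon U R).Quotient)

/-- The element of the ultraproduct represented by the sequence `a`. -/
def ultraMk (R : 𝕀 → Type*) [∀ r, CommRing (R r)] :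
    (∀ r, R r) →+* (U : Filter 𝕀).Product R :=
  (ultraCon U R).mk'

/-- Two sequences represent the same element iff they agree almost everywhere. -/
theorem ultraMk_eq_iff {R : 𝕀 → Type*} [∀ r, CommRing (R r)] {a b : ∀ r, R r} :
    ultraMk U R a = ultraMk U R b ↔ ∀ᶠ r in (U : Filter 𝕀), a r = b r :=
  (ultraCon U R).eq

theorem ultraMk_surjective (R : 𝕀 → Type*) [∀ r, CommRing (R r)] :
    Function.Surjective (ultraMk U R) :=
  Quotient.mk_surjective

/-- The ring homomorphism between ultraproducts that applies `f r` in coordinate `r`. -/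
def ultraMap {R S : 𝕀 → Type*} [∀ r, CommRing (R r)] [∀ r, CommRing (S r)]
    (f : ∀ r, R r →+* S r) : (U : Filter 𝕀).Product R →+* (U : Filter 𝕀).Product S :=
  (ultraCon U R).lift ((ultraMk U S).comp (RingHom.pi fun r => (f r).comp (Pi.evalRingHom R r)))
    fun _ _ h => (ultraMk_eq_iff U).2 (Filter.Eventually.mono h fun _ e => congrArg (f _) e)

/-- The coordinatewise derivation on an ultraproduct. -/
def ultraDerivation {R : 𝕀 → Type*} [∀ r, CommRing (R r)] (d : ∀ r, Derivation ℤ (R r) (R r)) :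
    Derivation ℤ ((U : Filter 𝕀).Product R) ((U : Filter 𝕀).Product R) :=
  Derivation.mk'
    (AddMonoidHom.toIntLinearMap
      { toFun := Quotient.map (fun a r => d r (a r)) fun _ _ h =>
          Filter.Eventually.mono h fun _ e => congrArg (d _) e
        map_zero' := (ultraMk_eq_iff U).2 (.of_forall fun r => map_zero (d r))
        map_add' := by
          rintro ⟨a⟩ ⟨b⟩
          exact (ultraMk_eq_iff U).2 (.of_forall fun r => map_add (d r) (a r) (b r)) })
    (by
      rintro ⟨a⟩ ⟨b⟩
      exact (ultraMk_eq_iff U).2 (.of_forall fun r => (d r).leibniz (a r) (b r)))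

/-- The natural (coordinatewise) `Δ`-ring structure on an ultraproduct of `Δ`-rings. -/
instance (m : ℕ) (R : 𝕀 → Type*) [∀ r, CommRing (R r)] [∀ r, DeltaRing m (R r)] :
    DeltaRing m ((U : Filter 𝕀).Product R) where
  δ i := ultraDerivation U fun r => DeltaRing.δ i
  δ_comm i j := by
    rintro ⟨a⟩
    exact (ultraMk_eq_iff U).2 (.of_forall fun r => DeltaRing.δ_comm i j (a r))

/-- Internal powers: for `N ∈ ℕ* = ∏_U ℕ`, the element `g ^ N` has coordinates
`g(r) ^ N(r)`. -/
def ultraPow {R : 𝕀 → Type*} [∀ r, CommRing (R r)] (g : (U : Filter 𝕀).Product R)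
    (N : (U : Filter 𝕀).Germ ℕ) : (U : Filter 𝕀).Product R :=
  Quotient.map₂ (fun (a : ∀ r, R r) (k : 𝕀 → ℕ) r => a r ^ k r)
    (fun _ _ h₁ _ _ h₂ => by
      filter_upwards [h₁, h₂] with r e₁ e₂
      rw [e₁, e₂]) g N

end Ultraproduct

/-! ### `Δ`-polynomials -/

section DeltaPolynomials

variable (m n : ℕ)

/-- The algebraic indeterminates `δ₁^{e₁} ⋯ δₘ^{eₘ} X_j`, encoded as `(j, e)`. -/
abbrev ThetaX : Type := Fin n × (Fin m → ℕ)

/-- The ring `k{X}` of `Δ`-polynomials over `k` in `X = (X₁, …, Xₙ)`: polynomials in the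
algebraic indeterminates. -/
abbrev DeltaPoly (k : Type*) [CommRing k] : Type _ := MvPolynomial (ThetaX m n) k

variable {m n}

/-- Applying an additive map `d` to all coefficients: `∑ a_M M ↦ ∑ d(a_M) M`. -/
def coeffMap {k σ : Type*} [CommRing k] (d : k →+ k) : MvPolynomial σ k →+ MvPolynomial σ k :=
  (Finsupp.liftAddHom fun M : σ →₀ ℕ => (MvPolynomial.monomial M).toAddMonoidHom.comp d).comp
    (AddMonoidAlgebra.coeffAddEquiv (R := k) (M := σ →₀ ℕ)).toAddMonoidHom

theorem coeffMap_monomial {k σ : Type*} [CommRing k] (d : k →+ k) (M : σ →₀ ℕ) (a : k) :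
    coeffMap d (MvPolynomial.monomial M a) = MvPolynomial.monomial M (d a) := by
  have h := MvPolynomial.sum_monomial_eq (u := M) (r := a)
    (b := fun M a => (MvPolynomial.monomial M (d a) : MvPolynomial σ k)) (by simp)
  exact h

/-- Applying a derivation `d` of `k` to all coefficients of a polynomial. -/
def coeffDerivation {k σ : Type*} [CommRing k] (d : Derivation ℤ k k) :
    Derivation ℤ (MvPolynomial σ k) (MvPolynomial σ k) :=
  Derivation.mk' (coeffMap (d : k →+ k)).toIntLinearMap (by
    intro f g
    change coeffMap (d : k →+ k) (f * g) =
      f • coeffMap (d : k →+ k) g + g • coeffMap (d : k →+ k) f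
    induction f using MvPolynomial.induction_on' with
    | add p q hp hq => simp only [add_mul, map_add, hp, hq, add_smul, smul_add]; abel
    | monomial u a =>
      induction g using MvPolynomial.induction_on' with
      | add p q hp hq => simp only [mul_add, map_add, hp, hq, add_smul, smul_add]; abel
      | monomial v b =>
        simp only [MvPolynomial.monomial_mul, coeffMap_monomial, smul_eq_mul]
        rw [add_comm v u, ← map_add]
        simp)

theorem coeffDerivation_monomial {k σ : Type*} [CommRing k] (d : Derivation ℤ k k) (M : σ →₀ ℕ)
    (a : k) :
    coeffDerivation d (MvPolynomial.monomial M a) = MvPolynomial.monomial M (d a) :=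
  coeffMap_monomial _ M a

/-- The derivation `δᵢ` of `k{X}`: it extends the given derivation of `k` and sends
`δ₁^{e₁} ⋯ δₘ^{eₘ} X_j` to `δ₁^{e₁} ⋯ δᵢ^{eᵢ + 1} ⋯ δₘ^{eₘ} X_j`. -/
def polyDerivation {k : Type*} [CommRing k] [DeltaRing m k] (i : Fin m) :
    Derivation ℤ (DeltaPoly m n k) (DeltaPoly m n k) :=
  coeffDerivation (DeltaRing.δ i) +
    (MvPolynomial.mkDerivation k fun v : ThetaX m n =>
      (MvPolynomial.X (v.1, v.2 + Pi.single i 1) : DeltaPoly m n k)).restrictScalars ℤ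

/-- The natural `Δ`-ring structure on `k{X}`. -/
instance {k : Type*} [CommRing k] [DeltaRing m k] : DeltaRing m (DeltaPoly m n k) where
  δ := polyDerivation
  δ_comm i j f := by
    have hC : ∀ (i : Fin m) (a : k), polyDerivation (n := n) i (MvPolynomial.C a) =
        MvPolynomial.C (DeltaRing.δ i a) := by
      intro i a
      have h := coeffDerivation_monomial (σ := ThetaX m n) (DeltaRing.δ i) 0 a
      rw [MvPolynomial.monomial_zero'] at h
      simpa [polyDerivation] using h
    have hX : ∀ (i : Fin m) (v : ThetaX m n), polyDerivation i (MvPolynomial.X v) =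
        (MvPolynomial.X (v.1, v.2 + Pi.single i 1) : DeltaPoly m n k) := by
      intro i v
      have h : coeffDerivation (DeltaRing.δ i : Derivation ℤ k k) (MvPolynomial.X v) = 0 :=
        (coeffDerivation_monomial _ _ _).trans (by simp)
      simp [polyDerivation, h]
    suffices h : ⁅polyDerivation (k := k) (n := n) i, polyDerivation j⁆ f = 0 by
      rwa [Derivation.commutator_apply, sub_eq_zero] at h
    induction f using MvPolynomial.induction_on with
    | C a => rw [Derivation.commutator_apply]; simp only [hC, DeltaRing.δ_comm i j, sub_self]
    | add p q hp hq => rw [map_add, hp, hq, add_zero]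
    | mul_X p v hp =>
      rw [Derivation.leibniz, hp, Derivation.commutator_apply]
      simp only [hX, add_right_comm v.2 (Pi.single i 1) (Pi.single j 1), sub_self, smul_zero,
        add_zero]

end DeltaPolynomials

/-! ### Internal `Δ`-polynomials -/

section Internal

variable {𝕀 : Type*} (U : Ultrafilter 𝕀) (m n : ℕ) (K : 𝕀 → Type*) [∀ r, CommRing (K r)]

/-- The ring `K{X}_int = ∏_U K_r{X}` of internal `Δ`-polynomials. -/
abbrev InternalDeltaPoly : Type _ := (U : Filter 𝕀).Product fun r => DeltaPoly m n (K r)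

/-- The natural embedding `φ : K{X} → K{X}_int`, where `K = ∏_U K_r`, that unpacks coefficients:
`∑ a_M M` goes to the internal polynomial with coordinates `∑ a_M(r) M`. It is the ring
homomorphism that sends `a ∈ K` to the class of the constant polynomials `a(r)`, and each
algebraic indeterminate to itself. -/
def unpack : DeltaPoly m n ((U : Filter 𝕀).Product K) →+* InternalDeltaPoly U m n K :=
  MvPolynomial.eval₂Hom
    (ultraMap U fun r => (MvPolynomial.C : K r →+* DeltaPoly m n (K r)))
    (fun v => ultraMk U (fun r => DeltaPoly m n (K r)) fun _ => MvPolynomial.X v)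

end Internal

end DeltaAlg

end

/-!
Write `K = ∏_U K_r`. The map `K{X} → K{X}_int` is the case `B_r = K_r` of the map
`K[X_v : v ∈ σ] → ∏_U B_r[X_v : v ∈ σ]` (`internalize`) for a family of `K_r`-algebras `B_r`. The
derivations play no role, and since ideals, relations and polynomials over `K` involve only
finitely many indeterminates, most questions reduce to `σ = Fin n`, the other indeterminates being
absorbed in `B_r` (`internalize_comp_rename`).

**Faithful flatness** says that every linear relation `∑ φ(f_i) x_i = 0` is a combination of
relations over `K[X]` and that `∑ φ(f_i) x_i = 1` implies `1 ∈ (f_i)`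
(`faithfullyFlat_of_relations`). For finitely many indeterminates, induct on their number. If some
`f_i` is nonzero, a linear change of coordinates makes it monic in the first indeterminate `T`, up
to a unit (`exists_isUnit_leadingCoeff_shear`). With `C_r = B_r[X₁, …, Xₙ]`, coordinatewise
division by this `f` then identifies `(∏_U C_r)[T] / f` with `(∏_U C_r[T]) / f`: internal
polynomials of finite degree are polynomials (`dividesWell_of_isUnit_leadingCoeff`). So the
equation may be solved in `(∏_U C_r)[T]`, which is faithfully flat over `K[X₁, …, Xₙ][T]` by
induction and base change.

**Primes extend to primes.** For a prime `P` of `K[X]` in finitely many indeterminates, Noether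
normalization and the primitive element theorem make the variety of `P` birational to a
hypersurface `f = 0` with `f` irreducible (`exists_hypersurface`). A factorization of the
coordinates `f(r)` has bounded degree, hence comes from a factorization of `f`, so almost all
`f(r)` are irreducible (`eventually_irreducible_coord`) and internal polynomials map to the
ultraproduct of the function fields of the `f(r)`. The kernel of this map is the ideal generated
by `P` (`isPrime_map_of_hypersurface`): an element `g` of the kernel is multiplied into that
ideal by an internal power of the common denominator `s`, and by flatness `s`, hence almost every
`s(r)`, is a nonzerodivisor modulo that ideal. For arbitrary index sets, take directed unions
(`exists_fg_isPrime_map`).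

The converse in (a) is contraction along a faithfully flat map. For (b), write the radical as an
intersection of primes; a prime extension of a finitely generated ideal is internal, so it
contains `g` if it contains some internal power of `g` (`mem_map_of_ultraPow_mem_map`).
-/

noncomputable section

namespace DeltaAlg

/-! ### An equational criterion for faithful flatness of ring homomorphisms -/

section Criterion

variable {R S : Type*} [CommRing R] [CommRing S]

/-- A ring homomorphism is faithfully flat if every linear relation over the target with
coefficients in the source is trivial, and the source contains a solution of each equation
`∑ fᵢ xᵢ = 1` that is solvable in the target. -/
theorem faithfullyFlat_of_relations (φ : R →+* S)
    (h₀ : ∀ (l : ℕ) (f : Fin l → R) (x : Fin l → S), ∑ i, φ (f i) * x i = 0 →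
      ∃ (κ : Type) (_ : Fintype κ) (a : Fin l → κ → R) (y : κ → S),
        (∀ i, x i = ∑ j, φ (a i j) * y j) ∧ ∀ j, ∑ i, f i * a i j = 0)
    (h₁ : ∀ (l : ℕ) (f : Fin l → R) (x : Fin l → S), ∑ i, φ (f i) * x i = 1 →
      ∃ g : Fin l → R, ∑ i, f i * g i = 1) : φ.FaithfullyFlat := by
  let := φ.toAlgebra
  have key : Module.FaithfullyFlat R S := by
    rw [Module.FaithfullyFlat.iff_flat_and_ideal_smul_eq_top]
    constructor
    · refine Module.Flat.of_forall_isTrivialRelation fun {l f x} h => ?_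
      obtain ⟨κ, _, a, y, hx, ha⟩ := h₀ l f x h
      let e := Fintype.equivFin κ
      refine ⟨Fintype.card κ, fun i j => a i (e.symm j), fun j => y (e.symm j), fun i => ?_,
        fun j => ha _⟩
      rw [hx i]
      exact (e.symm.sum_comp fun j => φ (a i j) * y j).symm
    · intro I hI
      have h1 : (1 : S) ∈ I.map φ := by
        have : (1 : S) ∈ I • (⊤ : Submodule R S) := by
          rw [hI]; exact Submodule.mem_top
        rw [Ideal.smul_top_eq_map] at this
        exact this
      obtain ⟨l, c, g, hg⟩ := Submodule.mem_span_set'.1 h1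
      choose f hf hfg using fun i => (g i).2
      obtain ⟨b, hb⟩ := h₁ l f c (by
        rw [← hg]
        exact Finset.sum_congr rfl fun i _ => by rw [hfg, smul_eq_mul, mul_comm])
      exact (Ideal.eq_top_iff_one _).2
        (hb ▸ I.sum_mem fun i _ => I.mul_mem_right _ (hf i))
  exact key

/-- Linear relations over a flat algebra are trivial. -/
theorem exists_of_sum_mul_eq_zero {φ : R →+* S} (hφ : φ.FaithfullyFlat) {ι : Type*} [Fintype ι]
    {f : ι → R} {x : ι → S} (h : ∑ i, φ (f i) * x i = 0) :
    ∃ (k : ℕ) (a : ι → Fin k → R) (y : Fin k → S),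
      (∀ i, x i = ∑ j, φ (a i j) * y j) ∧ ∀ j, ∑ i, f i * a i j = 0 := by
  let := φ.toAlgebra
  have : Module.Flat R S := hφ.flat
  exact Module.Flat.isTrivialRelation_of_sum_smul_eq_zero (R := R) (M := S) h

theorem comap_map_of_faithfullyFlat {φ : R →+* S} (hφ : φ.FaithfullyFlat) (I : Ideal R) :
    (I.map φ).comap φ = I := by
  let := φ.toAlgebra
  have : Module.FaithfullyFlat R S := hφ
  exact Ideal.comap_map_eq_self_of_faithfullyFlat (B := S) I

theorem map_mem_map_iff {φ : R →+* S} (hφ : φ.FaithfullyFlat) {I : Ideal R} {a : R} :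
    φ a ∈ I.map φ ↔ a ∈ I := by
  rw [← Ideal.mem_comap, comap_map_of_faithfullyFlat hφ]

/-- If `s` is a nonzerodivisor modulo `I`, it remains one modulo `I S` for flat `S`. -/
theorem mem_map_of_mul_mem_map {φ : R →+* S} (hφ : φ.FaithfullyFlat) {I : Ideal R} {s : R}
    (hs : ∀ a, s * a ∈ I → a ∈ I) {x : S} (hx : φ s * x ∈ I.map φ) : x ∈ I.map φ := by
  obtain ⟨l, c, g, hg⟩ := Submodule.mem_span_set'.1 hx
  choose f hf hfg using fun i => (g i).2
  have h : ∑ i : Option (Fin l), φ (i.elim s fun i => - f i) * (i.elim x c) = 0 := by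
    rw [Fintype.sum_option]
    simp only [Option.elim, map_neg, neg_mul, Finset.sum_neg_distrib]
    rw [← hg, ← sub_eq_add_neg, sub_eq_zero]
    exact Finset.sum_congr rfl fun i _ => by rw [hfg, smul_eq_mul, mul_comm]
  obtain ⟨k, a, y, hxy, ha⟩ := exists_of_sum_mul_eq_zero hφ h
  have hx' : x = _ := hxy none
  rw [hx']
  refine Ideal.sum_mem _ fun j _ => Ideal.mul_mem_right _ _ (Ideal.mem_map_of_mem _ (hs _ ?_))
  have := ha j
  rw [Fintype.sum_option] at this
  simp only [Option.elim, neg_mul, Finset.sum_neg_distrib] at this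
  rw [← sub_eq_add_neg, sub_eq_zero] at this
  exact this ▸ Ideal.sum_mem _ fun i _ => Ideal.mul_mem_right _ _ (hf i)

end Criterion

/-! ### Reduction of linear equations to a subring -/

section Reduction

variable {A C S : Type*} [CommRing A] [CommRing C] [CommRing S]

/-- The element `f` of `C` satisfies `C / f ≅ S / f`, in a strong form that reduces linear
equations over `S` to linear equations over `C`: the fields say that `C / f → S / f` is
surjective, and that a multiple `q f` lies in (the image of) `C` only for `q` in `C`. -/
structure DividesWell (j : C →+* S) (f : C) : Prop where
  exists_eq : ∀ x, ∃ q c, x = q * j f + j c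
  mem_range : ∀ q c, q * j f = j c → ∃ c', q = j c'

variable {φ : A →+* C} {j : C →+* S}

/-- A solution `x` over `S` of a linear equation one of whose coefficients divides well differs
from a solution `c` over `C` by a combination of Koszul relations. -/
theorem exists_reduction (hj : Function.Injective j) {ι : Type*} [Fintype ι] [DecidableEq ι]
    {f : ι → C} {i₀ : ι} (hf : DividesWell j (f i₀)) {x : ι → S} {b : C}
    (h : ∑ i, j (f i) * x i = j b) :
    ∃ (c : ι → C) (q : ι → S), ∑ i, f i * c i = b ∧
      ∀ i, x i = j (c i) + (q i * j (f i₀) - if i = i₀ then ∑ i', q i' * j (f i') else 0) := by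
  choose q' c' hx using fun i => hf.exists_eq (x i)
  let q : ι → S := fun i => if i = i₀ then 0 else q' i
  have hq : (x i₀ + ∑ i, q i * j (f i)) * j (f i₀) =
      j (b - ∑ i ∈ Finset.univ.erase i₀, f i * c' i) := by
    rw [map_sub, ← h, map_sum,
      ← Finset.add_sum_erase _ (fun i => q i * j (f i)) (Finset.mem_univ i₀),
      ← Finset.add_sum_erase _ (fun i => j (f i) * x i) (Finset.mem_univ i₀)]
    have e : ∑ i ∈ Finset.univ.erase i₀, j (f i) * x i =
        (∑ i ∈ Finset.univ.erase i₀, q i * j (f i)) * j (f i₀) +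
          ∑ i ∈ Finset.univ.erase i₀, j (f i * c' i) := by
      rw [Finset.sum_mul, ← Finset.sum_add_distrib]
      refine Finset.sum_congr rfl fun i hi => ?_
      have : q i = q' i := if_neg (Finset.ne_of_mem_erase hi)
      rw [this, map_mul]
      nth_rw 1 [hx i]
      ring
    rw [e]
    simp only [q, if_true]
    ring
  obtain ⟨c₀, hc₀⟩ := hf.mem_range _ _ hq
  let c : ι → C := fun i => if i = i₀ then c₀ else c' i
  have hxc : ∀ i, x i = j (c i) +
      (q i * j (f i₀) - if i = i₀ then ∑ i', q i' * j (f i') else 0) := by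
    intro i
    by_cases hi : i = i₀
    · subst hi
      simp only [c, q, if_true]
      rw [← hc₀]
      ring
    · simp only [c, q, hi, if_false]
      nth_rw 1 [hx i]
      ring
  refine ⟨c, q, hj ?_, hxc⟩
  rw [← h, map_sum]
  have : ∀ i, j (f i) * x i = j (f i * c i) + (q i * j (f i) * j (f i₀) -
      if i = i₀ then j (f i₀) * ∑ i', q i' * j (f i') else 0) := by
    intro i
    nth_rw 1 [hxc i]
    split_ifs with hi
    · subst hi; rw [map_mul]; ring
    · rw [map_mul]; ring
  rw [Finset.sum_congr rfl fun i _ => this i, Finset.sum_add_distrib, Finset.sum_sub_distrib,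
    Finset.sum_ite_eq' Finset.univ i₀, if_pos (Finset.mem_univ _), ← Finset.sum_mul]
  ring

/-- Relations over `A` with solutions in `S` are trivial if one coefficient divides well: they
are reduced to relations with solutions in `C` by subtracting Koszul relations. -/
theorem relation_of_dividesWell (hφ : φ.FaithfullyFlat) (hj : Function.Injective j)
    {ι : Type} [Fintype ι] [DecidableEq ι] {f : ι → A} {i₀ : ι}
    (hf : DividesWell j (φ (f i₀))) {x : ι → S} (h : ∑ i, j (φ (f i)) * x i = 0) :
    ∃ (κ : Type) (_ : Fintype κ) (a : ι → κ → A) (y : κ → S),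
        (∀ i, x i = ∑ k, j (φ (a i k)) * y k) ∧ ∀ k, ∑ i, f i * a i k = 0 := by
  obtain ⟨c, q, hc, hx⟩ := exists_reduction (f := fun i => φ (f i)) hj hf (h.trans (map_zero j).symm)
  obtain ⟨k, a, y, hcy, ha⟩ := exists_of_sum_mul_eq_zero hφ hc
  -- The relations over `C` come from `A` by flatness; the second summand of the index type
  -- carries the Koszul relations between `f i₀` and the other coefficients.
  refine ⟨Fin k ⊕ ι, inferInstance,
    fun i => Sum.elim (a i) fun i' => (if i = i' then f i₀ else 0) - if i = i₀ then f i' else 0,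
    Sum.elim (fun l => j (y l)) q, fun i => ?_, ?_⟩
  · rw [Fintype.sum_sum_type, hx i]
    congr 1
    · simp only [Sum.elim_inl, hcy i, map_sum, map_mul]
    · simp only [Sum.elim_inr, map_sub, sub_mul, Finset.sum_sub_distrib]
      congr 1
      · rw [Finset.sum_eq_single i]
        · simp [mul_comm]
        · intro b _ hb
          simp [hb.symm]
        · simp
      · split_ifs
        · exact Finset.sum_congr rfl fun _ _ => mul_comm _ _
        · simp
  · rintro (l | i')
    · exact ha l
    · simp only [Sum.elim_inr, mul_sub, Finset.sum_sub_distrib, mul_ite, mul_zero,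
        Finset.sum_ite_eq', Finset.mem_univ, if_true]
      ring

/-- An equation `∑ fᵢ xᵢ = 1` that is solvable over `S` is solvable over `A` if one coefficient
divides well. -/
theorem unit_of_dividesWell (hφ : φ.FaithfullyFlat) (hj : Function.Injective j)
    {ι : Type*} [Fintype ι] [DecidableEq ι] {f : ι → A} {i₀ : ι}
    (hf : DividesWell j (φ (f i₀))) {x : ι → S} (h : ∑ i, j (φ (f i)) * x i = 1) :
    ∃ g : ι → A, ∑ i, f i * g i = 1 := by
  obtain ⟨c, q, hc, -⟩ := exists_reduction (f := fun i => φ (f i)) hj hf (h.trans (map_one j).symm)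
  have h1 : φ 1 ∈ (Ideal.span (Set.range f)).map φ := by
    rw [map_one, ← hc]
    exact Ideal.sum_mem _ fun i _ => Ideal.mul_mem_right _ _
      (Ideal.mem_map_of_mem _ (Ideal.subset_span ⟨i, rfl⟩))
  obtain ⟨g, hg⟩ := (Ideal.mem_span_range_iff_exists_fun).1 ((map_mem_map_iff hφ).1 h1)
  exact ⟨g, by simpa only [mul_comm] using hg⟩

end Reduction

/-! ### Ultraproducts -/

section Ultra

variable {𝕀 : Type*} {U : Ultrafilter 𝕀}

theorem ultraMap_ultraMk {R S : 𝕀 → Type*} [∀ r, CommRing (R r)] [∀ r, CommRing (S r)]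
    (f : ∀ r, R r →+* S r) (a : ∀ r, R r) :
    ultraMap U f (ultraMk U R a) = ultraMk U S fun r => f r (a r) := rfl

theorem ultraMk_eq_zero_iff {R : 𝕀 → Type*} [∀ r, CommRing (R r)] {a : ∀ r, R r} :
    ultraMk U R a = 0 ↔ ∀ᶠ r in (U : Filter 𝕀), a r = 0 := by
  rw [← map_zero (ultraMk U R), ultraMk_eq_iff]
  rfl

instance ultraproduct_nontrivial (R : 𝕀 → Type*) [∀ r, CommRing (R r)] [∀ r, Nontrivial (R r)] :
    Nontrivial ((U : Filter 𝕀).Product R) := by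
  refine ⟨ultraMk U R 1, ultraMk U R 0, fun h => ?_⟩
  obtain ⟨r, hr⟩ := ((ultraMk_eq_iff U).1 h).exists
  exact one_ne_zero hr

instance ultraproduct_isDomain (R : 𝕀 → Type*) [∀ r, CommRing (R r)] [∀ r, IsDomain (R r)] :
    IsDomain ((U : Filter 𝕀).Product R) := by
  have : NoZeroDivisors ((U : Filter 𝕀).Product R) := by
    refine ⟨fun {a b} h => ?_⟩
    obtain ⟨a, rfl⟩ := ultraMk_surjective U R a
    obtain ⟨b, rfl⟩ := ultraMk_surjective U R b
    rw [← map_mul, ultraMk_eq_zero_iff] at h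
    rw [ultraMk_eq_zero_iff, ultraMk_eq_zero_iff, ← Ultrafilter.eventually_or]
    exact h.mono fun r hr => mul_eq_zero.1 hr
  exact NoZeroDivisors.to_isDomain _

theorem ultraproduct_isField (K : 𝕀 → Type*) [∀ r, Field (K r)] :
    IsField ((U : Filter 𝕀).Product K) where
  exists_pair_ne := exists_pair_ne _
  mul_comm := mul_comm
  mul_inv_cancel := by
    intro a ha
    obtain ⟨a, rfl⟩ := ultraMk_surjective U K a
    refine ⟨ultraMk U K fun r => (a r)⁻¹, ?_⟩
    rw [← map_mul, ← map_one (ultraMk U K), ultraMk_eq_iff]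
    rw [Ne, ultraMk_eq_zero_iff, ← Ultrafilter.eventually_not] at ha
    exact ha.mono fun r hr => mul_inv_cancel₀ hr

/-- The field structure on an ultraproduct of fields, extending its ring structure. -/
abbrev ultraField (K : 𝕀 → Type*) [∀ r, Field (K r)] : Field ((U : Filter 𝕀).Product K) :=
  (ultraproduct_isField K).toField

instance ultraproduct_charZero (K : 𝕀 → Type*) [∀ r, CommRing (K r)] [∀ r, CharZero (K r)] :
    CharZero ((U : Filter 𝕀).Product K) := by
  refine charZero_of_inj_zero fun n hn => ?_
  rw [← map_natCast (ultraMk U K), ultraMk_eq_zero_iff] at hn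
  obtain ⟨r, hr⟩ := hn.exists
  exact Nat.cast_eq_zero.1 hr

end Ultra

/-! ### Internal polynomials in one variable -/

section Univariate

open Polynomial

variable {𝕀 : Type*} {U : Ultrafilter 𝕀} {C : 𝕀 → Type*} [∀ r, CommRing (C r)]

variable (U C) in
/-- The natural map `(∏_U C_r)[T] → ∏_U C_r[T]`. -/
def internalizePoly : ((U : Filter 𝕀).Product C)[X] →+* (U : Filter 𝕀).Product fun r => (C r)[X] :=
  eval₂RingHom (ultraMap U fun r => (Polynomial.C : C r →+* (C r)[X]))
    (ultraMk U (fun r => (C r)[X]) fun _ => X)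

theorem internalizePoly_map (p : (∀ r, C r)[X]) :
    internalizePoly U C (p.map (ultraMk U C)) =
      ultraMk U (fun r => (C r)[X]) fun r => p.map (Pi.evalRingHom C r) := by
  let F : (∀ r, C r)[X] →+* (U : Filter 𝕀).Product fun r => (C r)[X] :=
    (ultraMk U fun r => (C r)[X]).comp (RingHom.pi fun r => mapRingHom (Pi.evalRingHom C r))
  have h : (internalizePoly U C).comp (mapRingHom (ultraMk U C)) = F := by
    refine Polynomial.ringHom_ext (fun a => ?_) ?_
    · change internalizePoly U C ((Polynomial.C a).map (ultraMk U C)) =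
        ultraMk U (fun r => (C r)[X]) fun r => (Polynomial.C a).map (Pi.evalRingHom C r)
      simp only [Polynomial.map_C, internalizePoly, coe_eval₂RingHom, eval₂_C, ultraMap_ultraMk]
      rfl
    · change internalizePoly U C ((X : (∀ r, C r)[X]).map (ultraMk U C)) =
        ultraMk U (fun r => (C r)[X]) fun r => (X : (∀ r, C r)[X]).map (Pi.evalRingHom C r)
      simp only [Polynomial.map_X, internalizePoly, coe_eval₂RingHom, eval₂_X]
  exact RingHom.congr_fun h p

theorem internalizePoly_injective : Function.Injective (internalizePoly U C) := by
  refine (injective_iff_map_eq_zero _).2 fun p hp => ?_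
  obtain ⟨p, rfl⟩ := Polynomial.map_surjective _ (ultraMk_surjective U C) p
  rw [internalizePoly_map, ultraMk_eq_zero_iff] at hp
  ext i
  rw [coeff_map, coeff_zero, ultraMk_eq_zero_iff]
  refine hp.mono fun r hr => ?_
  have := congrArg (fun q => coeff q i) hr
  simpa using this

/-- Internal polynomials of finite degree have finitely many internal coefficients, so they are
polynomials. -/
theorem exists_internalizePoly_eq (x : ∀ r, (C r)[X]) (D : ℕ) (h : ∀ r, (x r).natDegree ≤ D) :
    ∃ c, ultraMk U (fun r => (C r)[X]) x = internalizePoly U C c := by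
  refine ⟨(∑ i ∈ Finset.range (D + 1),
    monomial i fun r => (x r).coeff i : (∀ r, C r)[X]).map (ultraMk U C), ?_⟩
  rw [internalizePoly_map]
  congr 1
  funext r
  rw [Polynomial.map_sum]
  refine ((x r).as_sum_range' (D + 1) (Nat.lt_succ_of_le (h r))).trans ?_
  exact Finset.sum_congr rfl fun i _ => by rw [Polynomial.map_monomial]; rfl

/-- Coordinatewise division with remainder by a monic polynomial `f` leaves remainders of bounded
degree, and the quotient has bounded degree if the dividend has. -/
theorem dividesWell_of_monic [∀ r, Nontrivial (C r)] {f : ((U : Filter 𝕀).Product C)[X]}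
    (hf : f.Monic) : DividesWell (internalizePoly U C) f := by
  obtain ⟨F, rfl, -, hF⟩ := lifts_and_degree_eq_and_monic
    ((Polynomial.mem_lifts f).2 (Polynomial.map_surjective _ (ultraMk_surjective U C) f)) hf
  have hFr : ∀ r, (F.map (Pi.evalRingHom C r)).Monic := fun r => hF.map _
  rw [← Polynomial.coe_mapRingHom] at *
  constructor
  · intro x
    obtain ⟨x, rfl⟩ := ultraMk_surjective U _ x
    obtain ⟨c, hc⟩ := exists_internalizePoly_eq (U := U)
      (fun r => x r %ₘ F.map (Pi.evalRingHom C r)) F.natDegree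
      fun r => (natDegree_modByMonic_le _ (hFr r)).trans natDegree_map_le
    refine ⟨ultraMk U _ fun r => x r /ₘ F.map (Pi.evalRingHom C r), c, ?_⟩
    rw [← hc, coe_mapRingHom, internalizePoly_map, ← map_mul, ← map_add]
    congr 1
    funext r
    change x r = (x r /ₘ F.map (Pi.evalRingHom C r)) * F.map (Pi.evalRingHom C r) +
      x r %ₘ F.map (Pi.evalRingHom C r)
    rw [add_comm, mul_comm, modByMonic_add_div]
  · intro q c h
    obtain ⟨q, rfl⟩ := ultraMk_surjective U _ q
    obtain ⟨c, rfl⟩ := Polynomial.map_surjective _ (ultraMk_surjective U C) c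
    rw [coe_mapRingHom, internalizePoly_map, internalizePoly_map, ← map_mul, ultraMk_eq_iff] at h
    classical
    -- The degree bound holds only almost everywhere, so `q` is cut off elsewhere.
    obtain ⟨c', hc'⟩ := exists_internalizePoly_eq (U := U)
      (fun r => if (q r).natDegree ≤ c.natDegree then q r else 0) c.natDegree fun r => by
        split_ifs with h
        · exact h
        · simp
    refine ⟨c', ?_⟩
    rw [← hc', ultraMk_eq_iff]
    refine h.mono fun r hr => (if_pos ?_).symm
    by_cases h0 : q r = 0
    · simp [h0]
    · have e : (q r * F.map (Pi.evalRingHom C r)).natDegree ≤ c.natDegree := by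
        change q r * F.map (Pi.evalRingHom C r) = _ at hr
        rw [hr]
        exact natDegree_map_le
      rw [mul_comm, (hFr r).natDegree_mul' h0] at e
      omega

theorem dividesWell_of_isUnit_leadingCoeff [∀ r, Nontrivial (C r)]
    {f : ((U : Filter 𝕀).Product C)[X]} (hf : IsUnit f.leadingCoeff) :
    DividesWell (internalizePoly U C) f := by
  obtain ⟨u, hu⟩ := hf
  have hm : (Polynomial.C (↑u⁻¹ : (U : Filter 𝕀).Product C) * f).Monic := by
    have := Polynomial.monic_C_mul_of_mul_leadingCoeff_eq_one
      (p := f) (b := (↑u⁻¹ : (U : Filter 𝕀).Product C)) (by rw [← hu, Units.inv_mul])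
    exact this
  have hfu : f = Polynomial.C (u : (U : Filter 𝕀).Product C) *
      (Polynomial.C (↑u⁻¹ : (U : Filter 𝕀).Product C) * f) := by
    rw [← mul_assoc, ← Polynomial.C_mul, Units.mul_inv, Polynomial.C_1, one_mul]
  have hd := dividesWell_of_monic hm
  constructor
  · intro x
    obtain ⟨q, c, h⟩ := hd.exists_eq x
    refine ⟨q * internalizePoly U C (Polynomial.C ↑u⁻¹), c, ?_⟩
    rw [h, map_mul, mul_assoc]
  · intro q c h
    refine hd.mem_range q (Polynomial.C (↑u⁻¹ : (U : Filter 𝕀).Product C) * c) ?_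
    rw [map_mul, map_mul, ← h]
    ring

end Univariate

/-! ### A linear change of coordinates -/

section Shear

open MvPolynomial

variable {B : Type*} [CommRing B] {n : ℕ}

/-- The isomorphism `B[X₀, …, Xₙ] ≃ B[X₁, …, Xₙ][T]` with `X₀ ↦ T` and `Xᵢ ↦ Xᵢ + cᵢ T` for
`i ≥ 1` (with indices shifted by one on the right). -/
def shear (c : Fin n → B) : MvPolynomial (Fin (n + 1)) B ≃ₐ[B] Polynomial (MvPolynomial (Fin n) B) :=
  AlgEquiv.ofAlgHom
    (aeval (Fin.cons Polynomial.X fun i => Polynomial.C (X i) +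
      Polynomial.C (C (c i)) * Polynomial.X))
    { Polynomial.eval₂RingHom (aeval fun i => X i.succ - C (c i) * X 0 :
        MvPolynomial (Fin n) B →ₐ[B] MvPolynomial (Fin (n + 1)) B).toRingHom (X 0) with
      commutes' := fun b => by
        have : algebraMap B (Polynomial (MvPolynomial (Fin n) B)) b = Polynomial.C (C b) := rfl
        simp [this, algebraMap_eq] }
    (by
      refine AlgHom.coe_ringHom_injective (Polynomial.ringHom_ext' ?_ ?_)
      · refine MvPolynomial.ringHom_ext (fun b => ?_) fun i => ?_
        · simp [algebraMap_eq]
        · have : (algebraMap B (Polynomial (MvPolynomial (Fin n) B))) (c i) =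
            Polynomial.C (C (c i)) := rfl
          simp [this]
      · simp)
    (by
      refine MvPolynomial.algHom_ext fun i => ?_
      refine Fin.cases ?_ (fun i => ?_) i <;> simp)

theorem shear_X_zero (c : Fin n → B) : shear c (X 0) = Polynomial.X := by
  simp [shear]

theorem shear_X_succ (c : Fin n → B) (i : Fin n) : shear c (X i.succ) =
    Polynomial.C (X i) + Polynomial.C (C (c i)) * Polynomial.X := by
  simp [shear]

theorem shear_C (c : Fin n → B) (b : B) : shear c (C b) = Polynomial.C (C b) := by
  simp [shear]

theorem shear_X_natDegree_le (c : Fin n → B) (i : Fin (n + 1)) :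
    (shear c (X i)).natDegree ≤ 1 := by
  refine Fin.cases ?_ (fun i => ?_) i
  · rw [shear_X_zero]; exact Polynomial.natDegree_X_le
  · rw [shear_X_succ, add_comm]; exact Polynomial.natDegree_linear_le

theorem shear_X_coeff_one (c : Fin n → B) (i : Fin (n + 1)) :
    (shear c (X i)).coeff 1 = C (Fin.cons (α := fun _ => B) 1 c i) := by
  refine Fin.cases ?_ (fun i => ?_) i
  · simp [shear_X_zero]
  · simp [shear_X_succ, Polynomial.coeff_C]

theorem shear_monomial (c : Fin n → B) (m : Fin (n + 1) →₀ ℕ) :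
    (shear c (monomial m 1)).natDegree ≤ m.degree ∧
      (shear c (monomial m 1)).coeff m.degree =
        C (eval (Fin.cons (α := fun _ => B) 1 c) (monomial m 1)) := by
  induction m using Finsupp.induction_linear with
  | zero => simp
  | add m m' h h' =>
    have e : (monomial (m + m') 1 : MvPolynomial (Fin (n + 1)) B) =
      monomial m 1 * monomial m' 1 := by rw [monomial_mul, one_mul]
    rw [e, map_mul, map_mul, map_mul, map_add]
    exact ⟨Polynomial.natDegree_mul_le_of_le h.1 h'.1, by
      rw [Polynomial.coeff_mul_add_eq_of_natDegree_le h.1 h'.1, h.2, h'.2]⟩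
  | single i k =>
    rw [← X_pow_eq_monomial, map_pow, map_pow, map_pow, Finsupp.degree_single]
    constructor
    · simpa using Polynomial.natDegree_pow_le_of_le k (shear_X_natDegree_le c i)
    · have := Polynomial.coeff_pow_of_natDegree_le (m := k) (shear_X_natDegree_le c i)
      rw [mul_one] at this
      rw [this, shear_X_coeff_one, eval_X]

/-- A form of degree `d` becomes a polynomial of degree at most `d` in `T`, with the value of the
form at `(1, c)` as the coefficient of `T ^ d`. -/
theorem shear_of_isHomogeneous (c : Fin n → B) {p : MvPolynomial (Fin (n + 1)) B} {d : ℕ}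
    (hp : p.IsHomogeneous d) :
    (shear c p).natDegree ≤ d ∧
      (shear c p).coeff d = C (eval (Fin.cons (α := fun _ => B) 1 c) p) := by
  have hd : ∀ m ∈ p.support, m.degree = d := fun m hm => (hp.degree_eq_sum_deg_support hm).symm
  have hm : ∀ m, monomial m (coeff m p) = C (coeff m p) * monomial m 1 := fun m => by
    rw [C_mul_monomial, mul_one]
  rw [p.as_sum, map_sum, map_sum, map_sum]
  constructor
  · refine Polynomial.natDegree_sum_le_of_forall_le _ _ fun m h => ?_
    rw [hm, map_mul, shear_C]
    exact (Polynomial.natDegree_C_mul_le _ _).trans (hd m h ▸ (shear_monomial c m).1)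
  · rw [Polynomial.finsetSum_coeff]
    refine Finset.sum_congr rfl fun m h => ?_
    rw [hm, map_mul, shear_C, Polynomial.coeff_C_mul, map_mul, map_mul, eval_C, ← hd m h,
      (shear_monomial c m).2]

theorem eval_mul_of_isHomogeneous {σ : Type*} {p : MvPolynomial σ B} {d : ℕ}
    (hp : p.IsHomogeneous d) (t : B) (e : σ → B) :
    eval (fun i => t * e i) p = t ^ d * eval e p := by
  rw [eval_eq, eval_eq, Finset.mul_sum]
  refine Finset.sum_congr rfl fun m hm => ?_
  simp only [mul_pow, Finset.prod_mul_distrib, Finset.prod_pow_eq_pow_sum]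
  rw [← hp.degree_eq_sum_deg_support hm]
  ring

/-- Over an infinite field, a generic linear change of coordinates makes a given nonzero
polynomial monic in the first variable, up to a unit. -/
theorem exists_isUnit_leadingCoeff_shear {k : Type*} [Field k] [Infinite k]
    {f : MvPolynomial (Fin (n + 1)) k} (hf : f ≠ 0) :
    ∃ c : Fin n → k, IsUnit (shear c f).leadingCoeff := by
  set D := f.totalDegree
  have hD : homogeneousComponent D f ≠ 0 := by
    obtain ⟨m, hm, hmD⟩ := Finset.exists_mem_eq_sup f.support (support_nonempty.2 hf)
      (fun s => s.sum fun _ e => e)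
    intro h
    have := congrArg (coeff m) h
    rw [coeff_homogeneousComponent, coeff_zero, if_pos (show m.degree = D from hmD.symm)] at this
    exact mem_support_iff.1 hm this
  -- A zero coordinate `a 0` has to be avoided for the rescaling of `a` to `(1, c)`.
  obtain ⟨a, ha⟩ : ∃ a : Fin (n + 1) → k, eval a (X 0 * homogeneousComponent D f) ≠ 0 := by
    by_contra! h
    exact mul_ne_zero (X_ne_zero 0) hD (MvPolynomial.funext fun a => by rw [h a, map_zero])
  rw [map_mul, eval_X] at ha
  let c : Fin n → k := fun i => a i.succ / a 0
  have hc : eval (Fin.cons (α := fun _ => k) 1 c) (homogeneousComponent D f) ≠ 0 := by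
    intro h
    have := eval_mul_of_isHomogeneous (homogeneousComponent_isHomogeneous D f) (a 0)
      (Fin.cons (α := fun _ => k) 1 c)
    rw [h, mul_zero] at this
    have e : (fun i => a 0 * Fin.cons (α := fun _ => k) 1 c i) = a := by
      funext i
      refine Fin.cases ?_ (fun i => ?_) i
      · simp
      · simp only [Fin.cons_succ, c]
        exact mul_div_cancel₀ _ (left_ne_zero_of_mul ha)
    rw [e] at this
    exact right_ne_zero_of_mul ha this
  have hdeg : (shear c f).natDegree ≤ D := by
    rw [← sum_homogeneousComponent f, map_sum]
    refine Polynomial.natDegree_sum_le_of_forall_le _ _ fun i hi => ?_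
    exact (shear_of_isHomogeneous c (homogeneousComponent_isHomogeneous i f)).1.trans
      (Nat.le_of_lt_succ (Finset.mem_range.1 hi))
  have hcoeff : (shear c f).coeff D =
      C (eval (Fin.cons (α := fun _ => k) 1 c) (homogeneousComponent D f)) := by
    nth_rw 1 [← sum_homogeneousComponent f]
    rw [map_sum, Polynomial.finsetSum_coeff, Finset.sum_eq_single D]
    · exact (shear_of_isHomogeneous c (homogeneousComponent_isHomogeneous D f)).2
    · intro i hi hiD
      have := Finset.mem_range.1 hi
      exact Polynomial.coeff_eq_zero_of_natDegree_lt
        ((shear_of_isHomogeneous c (homogeneousComponent_isHomogeneous i f)).1.trans_lt (by omega))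
    · simp [D]
  have hu : IsUnit ((shear c f).coeff D) := hcoeff ▸ (IsUnit.mk0 _ hc).map C
  refine ⟨c, ?_⟩
  rwa [Polynomial.leadingCoeff, hdeg.antisymm (Polynomial.le_natDegree_of_ne_zero hu.ne_zero)]

end Shear

/-! ### Faithful flatness of internal polynomials -/

section Internalize

open MvPolynomial

variable {𝕀 : Type*} {U : Ultrafilter 𝕀} {K : 𝕀 → Type*} {B : 𝕀 → Type*}

section Ring

variable [∀ r, CommRing (K r)] [∀ r, CommRing (B r)] [∀ r, Algebra (K r) (B r)]

variable (U K B) in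
/-- The natural map `(∏_U K_r)[X_v : v ∈ σ] → ∏_U B_r[X_v : v ∈ σ]` for a family of
`K_r`-algebras `B_r`. For `B_r = K_r` this is `unpack`; other algebras `B_r` serve to
split off finitely many among infinitely many indeterminates. -/
def internalize (σ : Type*) : MvPolynomial σ ((U : Filter 𝕀).Product K) →+*
    (U : Filter 𝕀).Product fun r => MvPolynomial σ (B r) :=
  eval₂Hom (ultraMap U fun r => (C : B r →+* MvPolynomial σ (B r)).comp (algebraMap (K r) (B r)))
    (fun v => ultraMk U (fun r => MvPolynomial σ (B r)) fun _ => X v)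

variable {σ τ : Type*}

theorem internalize_C (a : ∀ r, K r) : internalize U K B σ (C (ultraMk U K a)) =
    ultraMk U (fun r => MvPolynomial σ (B r)) fun r => C (algebraMap (K r) (B r) (a r)) := by
  simp only [internalize, coe_eval₂Hom, eval₂_C, ultraMap_ultraMk]
  rfl

theorem internalize_X (v : σ) : internalize U K B σ (X v) =
    ultraMk U (fun r => MvPolynomial σ (B r)) fun _ => X v := by
  simp only [internalize, coe_eval₂Hom, eval₂_X]

/-- The coordinate `p(r)` of a polynomial `p` whose coefficients are represented by sequences. -/
def coord (B : 𝕀 → Type*) [∀ r, CommRing (B r)] [∀ r, Algebra (K r) (B r)] (r : 𝕀) :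
    MvPolynomial σ (∀ r, K r) →+* MvPolynomial σ (B r) :=
  map ((algebraMap (K r) (B r)).comp (Pi.evalRingHom K r))

theorem internalize_map (p : MvPolynomial σ (∀ r, K r)) :
    internalize U K B σ (map (ultraMk U K) p) =
      ultraMk U (fun r => MvPolynomial σ (B r)) fun r => coord B r p := by
  have h : (internalize U K B σ).comp (map (ultraMk U K)) =
      (ultraMk U fun r => MvPolynomial σ (B r)).comp (RingHom.pi fun r => coord B r) := by
    refine MvPolynomial.ringHom_ext (fun a => ?_) fun v => ?_
    · rw [RingHom.comp_apply, map_C, internalize_C, RingHom.comp_apply]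
      congr 1
      funext r
      exact (map_C ((algebraMap (K r) (B r)).comp (Pi.evalRingHom K r)) a).symm
    · rw [RingHom.comp_apply, map_X, internalize_X, RingHom.comp_apply]
      congr 1
      funext r
      exact (map_X ((algebraMap (K r) (B r)).comp (Pi.evalRingHom K r)) v).symm
  exact RingHom.congr_fun h p

theorem exists_lift (p : MvPolynomial σ ((U : Filter 𝕀).Product K)) :
    ∃ q : MvPolynomial σ (∀ r, K r), map (ultraMk U K) q = p :=
  MvPolynomial.map_surjective _ (ultraMk_surjective U K) p

/-- Internalization commutes with linear changes of coordinates. -/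
theorem shear_internalize {n : ℕ} (c : Fin n → ∀ r, K r)
    (p : MvPolynomial (Fin (n + 1)) ((U : Filter 𝕀).Product K)) :
    ultraMap U (fun r => (shear fun i => algebraMap (K r) (B r) (c i r)).toRingEquiv.toRingHom)
      (internalize U K B (Fin (n + 1)) p) =
    internalizePoly U (fun r => MvPolynomial (Fin n) (B r))
      (Polynomial.mapRingHom (internalize U K B (Fin n)) (shear (fun i => ultraMk U K (c i)) p)) := by
  have hC : ∀ x : ∀ r, MvPolynomial (Fin n) (B r),
      internalizePoly U (fun r => MvPolynomial (Fin n) (B r)) (Polynomial.C (ultraMk U _ x)) =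
        ultraMk U (fun r => Polynomial (MvPolynomial (Fin n) (B r))) fun r =>
          Polynomial.C (x r) := fun x => by
    simp only [internalizePoly, Polynomial.coe_eval₂RingHom, Polynomial.eval₂_C, ultraMap_ultraMk]
  have hT : internalizePoly U (fun r => MvPolynomial (Fin n) (B r)) Polynomial.X =
      ultraMk U (fun r => Polynomial (MvPolynomial (Fin n) (B r))) fun r => Polynomial.X := by
    simp only [internalizePoly, Polynomial.coe_eval₂RingHom, Polynomial.eval₂_X]
  have h : (ultraMap U fun r =>
        (shear fun i => algebraMap (K r) (B r) (c i r)).toRingEquiv.toRingHom).comp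
        (internalize U K B (Fin (n + 1))) =
      (internalizePoly U (fun r => MvPolynomial (Fin n) (B r))).comp
        ((Polynomial.mapRingHom (internalize U K B (Fin n))).comp
          (shear (fun i => ultraMk U K (c i))).toRingEquiv.toRingHom) := by
    refine MvPolynomial.ringHom_ext (fun a => ?_) fun v => ?_
    · obtain ⟨a, rfl⟩ := ultraMk_surjective U K a
      have e : (shear fun i => ultraMk U K (c i)).toRingEquiv.toRingHom (C (ultraMk U K a)) =
        Polynomial.C (C (ultraMk U K a)) := shear_C _ _
      rw [RingHom.comp_apply, RingHom.comp_apply, RingHom.comp_apply, e, internalize_C,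
        ultraMap_ultraMk, Polynomial.coe_mapRingHom, Polynomial.map_C, internalize_C, hC]
      congr 1
      funext r
      exact shear_C _ _
    · rw [RingHom.comp_apply, RingHom.comp_apply, RingHom.comp_apply, internalize_X,
        ultraMap_ultraMk, Polynomial.coe_mapRingHom]
      refine Fin.cases ?_ (fun i => ?_) v
      · have e : (shear fun i => ultraMk U K (c i)).toRingEquiv.toRingHom (X 0) =
          Polynomial.X := shear_X_zero _
        rw [e, Polynomial.map_X, hT]
        congr 1
        funext r
        exact shear_X_zero _
      · have e : (shear fun i => ultraMk U K (c i)).toRingEquiv.toRingHom (X i.succ) =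
          _ := shear_X_succ _ _
        rw [e, Polynomial.map_add, Polynomial.map_mul, Polynomial.map_X, Polynomial.map_C,
          Polynomial.map_C, map_add, map_mul, hT, internalize_C, internalize_X, hC, hC,
          ← map_mul, ← map_add]
        congr 1
        funext r
        exact shear_X_succ _ _
  exact RingHom.congr_fun h p

end Ring

variable [∀ r, Field (K r)] [∀ r, CommRing (B r)] [∀ r, Algebra (K r) (B r)]
  [∀ r, Nontrivial (B r)]

theorem faithfullyFlat_comp {R S T : Type*} [CommRing R] [CommRing S] [CommRing T] {φ : R →+* S}
    {ψ : S →+* T} (hφ : φ.FaithfullyFlat) (hψ : ψ.FaithfullyFlat) : (ψ.comp φ).FaithfullyFlat := by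
  algebraize [φ, ψ, ψ.comp φ]
  have : Module.FaithfullyFlat R S := hφ
  have : Module.FaithfullyFlat S T := hψ
  exact Module.FaithfullyFlat.trans R S T

theorem faithfullyFlat_mapRingHom {R S : Type*} [CommRing R] [CommRing S] {φ : R →+* S}
    (hφ : φ.FaithfullyFlat) : (Polynomial.mapRingHom φ).FaithfullyFlat := by
  algebraize [φ]
  have : Module.FaithfullyFlat R S := hφ
  let := Polynomial.algebra R S
  have h : IsBaseChange (Polynomial R) (IsScalarTower.toAlgHom R S (Polynomial S)).toLinearMap :=
    Algebra.IsPushout.out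
  have h' : Module.FaithfullyFlat (Polynomial R) (Polynomial S) :=
    Module.FaithfullyFlat.of_linearEquiv _ _ h.equiv.symm
  have : (algebraMap (Polynomial R) (Polynomial S)).FaithfullyFlat :=
    RingHom.faithfullyFlat_algebraMap_iff.2 h'
  exact this

/-- Without indeterminates, the source is a field. -/
theorem internalize_faithfullyFlat_zero : (internalize U K B (Fin 0)).FaithfullyFlat := by
  let := ultraField (U := U) K
  let e := isEmptyAlgEquiv ((U : Filter 𝕀).Product K) (Fin 0)
  have h : ((internalize U K B (Fin 0)).comp
      (C : (U : Filter 𝕀).Product K →+* _)).FaithfullyFlat := by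
    let := ((internalize U K B (Fin 0)).comp (C : (U : Filter 𝕀).Product K →+* _)).toAlgebra
    exact (inferInstance : Module.FaithfullyFlat ((U : Filter 𝕀).Product K)
      ((U : Filter 𝕀).Product fun r => MvPolynomial (Fin 0) (B r)))
  have h' : internalize U K B (Fin 0) = ((internalize U K B (Fin 0)).comp
      (C : (U : Filter 𝕀).Product K →+* _)).comp e.toRingEquiv.toRingHom := by
    refine RingHom.ext fun p => ?_
    have : p = C (e p) := by
      rw [← MvPolynomial.algebraMap_eq, ← e.symm.commutes]
      simp
    change _ = internalize U K B (Fin 0) (C (e p))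
    rw [← this]
  rw [h']
  exact faithfullyFlat_comp (RingHom.FaithfullyFlat.of_bijective e.bijective) h

theorem internalize_faithfullyFlat_fin [∀ r, CharZero (K r)] (n : ℕ) :
    (internalize U K B (Fin n)).FaithfullyFlat := by
  induction n with
  | zero => exact internalize_faithfullyFlat_zero
  | succ n ih =>
    let := ultraField (U := U) K
    have hA := faithfullyFlat_mapRingHom ih
    -- After a change of coordinates, one coefficient is monic up to a unit.
    have key : ∀ {l : ℕ} (f : Fin l → MvPolynomial (Fin (n + 1)) ((U : Filter 𝕀).Product K))
        (i₀ : Fin l), f i₀ ≠ 0 → ∃ c : Fin n → ∀ r, K r,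
        DividesWell (internalizePoly U fun r => MvPolynomial (Fin n) (B r))
          (Polynomial.mapRingHom (internalize U K B (Fin n))
            (shear (fun i => ultraMk U K (c i)) (f i₀))) := by
      intro l f i₀ hf
      obtain ⟨c, hc⟩ := exists_isUnit_leadingCoeff_shear hf
      choose c' hc' using fun i => ultraMk_surjective U K (c i)
      obtain rfl : (fun i => ultraMk U K (c' i)) = c := funext hc'
      refine ⟨c', dividesWell_of_isUnit_leadingCoeff ?_⟩
      rw [Polynomial.coe_mapRingHom,
        Polynomial.leadingCoeff_map_of_injective ih.injective]
      exact hc.map _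
    refine faithfullyFlat_of_relations _ (fun l f x h => ?_) (fun l f x h => ?_)
    · by_cases h0 : ∀ i, f i = 0
      · exact ⟨Fin l, inferInstance, fun i j => if i = j then 1 else 0, x,
          fun i => by simp [apply_ite (internalize U K B (Fin (n + 1)))], fun j => by simp [h0]⟩
      · push Not at h0
        obtain ⟨i₀, hi₀⟩ := h0
        obtain ⟨c, hc⟩ := key f i₀ hi₀
        let E : ∀ r, MvPolynomial (Fin (n + 1)) (B r) ≃+*
          Polynomial (MvPolynomial (Fin n) (B r)) :=
          fun r => (shear fun i => algebraMap (K r) (B r) (c i r)).toRingEquiv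
        let F := shear fun i => ultraMk U K (c i)
        have hE : ∀ y, ultraMap U (fun r => (E r).symm.toRingHom)
            (ultraMap U (fun r => (E r).toRingHom) y) = y := fun y => by
          obtain ⟨y, rfl⟩ := ultraMk_surjective U _ y
          rw [ultraMap_ultraMk, ultraMap_ultraMk]
          congr 1
          funext r
          exact (E r).symm_apply_apply _
        have h' := congrArg (ultraMap U fun r => (E r).toRingHom) h
        simp only [map_sum, map_mul, map_zero, E, shear_internalize] at h'
        obtain ⟨κ, _, a, y, hy, ha⟩ := relation_of_dividesWell
          (f := fun i => F (f i)) hA internalizePoly_injective hc h'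
        refine ⟨κ, inferInstance, fun i k => F.symm (a i k),
          fun k => ultraMap U (fun r => (E r).symm.toRingHom) (y k), fun i => ?_, fun k => ?_⟩
        · rw [← hE (x i), hy i, map_sum]
          refine Finset.sum_congr rfl fun k _ => ?_
          rw [map_mul, ← hE (internalize U K B (Fin (n + 1)) (F.symm (a i k)))]
          simp only [E, shear_internalize, F, AlgEquiv.apply_symm_apply]
        · have := congrArg F.symm (ha k)
          simpa using this
    · by_cases h0 : ∀ i, f i = 0
      · simp [h0] at h
      · push Not at h0
        obtain ⟨i₀, hi₀⟩ := h0
        obtain ⟨c, hc⟩ := key f i₀ hi₀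
        let F := shear fun i => ultraMk U K (c i)
        have h' := congrArg (ultraMap U fun r =>
          (shear fun i => algebraMap (K r) (B r) (c i r)).toRingEquiv.toRingHom) h
        simp only [map_sum, map_mul, map_one, shear_internalize] at h'
        obtain ⟨g, hg⟩ := unit_of_dividesWell
          (f := fun i => F (f i)) hA internalizePoly_injective hc h'
        refine ⟨fun i => F.symm (g i), ?_⟩
        have := congrArg F.symm hg
        simpa using this

end Internalize

/-! ### Reduction to finitely many indeterminates -/

section Split

open MvPolynomial

variable {𝕀 : Type*} {U : Ultrafilter 𝕀}

theorem ultraMap_bijective {R S : 𝕀 → Type*} [∀ r, CommRing (R r)] [∀ r, CommRing (S r)]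
    {f : ∀ r, R r →+* S r} (hf : ∀ r, Function.Bijective (f r)) :
    Function.Bijective (ultraMap U f) := by
  constructor
  · refine (injective_iff_map_eq_zero _).2 fun a ha => ?_
    obtain ⟨a, rfl⟩ := ultraMk_surjective U R a
    rw [ultraMap_ultraMk, ultraMk_eq_zero_iff] at ha
    rw [ultraMk_eq_zero_iff]
    exact ha.mono fun r hr => (map_eq_zero_iff _ (hf r).1).1 hr
  · intro b
    obtain ⟨b, rfl⟩ := ultraMk_surjective U S b
    choose a ha using fun r => (hf r).2 (b r)
    exact ⟨ultraMk U R a, by rw [ultraMap_ultraMk]; simp only [ha]⟩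

/-- Split off the indeterminates in the image of `i` as outer indeterminates. -/
def splitEquiv {V τ : Type*} {i : τ → V} (hi : Function.Injective i) (B : Type*) [CommRing B] :
    MvPolynomial τ (MvPolynomial ↥(Set.range i)ᶜ B) ≃ₐ[B] MvPolynomial V B :=
  (sumAlgEquiv B τ ↥(Set.range i)ᶜ).symm.trans (renameEquiv B
    ((Equiv.sumCongr (Equiv.ofInjective i hi) (Equiv.refl _)).trans
      (by classical exact Equiv.Set.sumCompl (Set.range i))))

theorem splitEquiv_X {V τ : Type*} {i : τ → V} (hi : Function.Injective i) (B : Type*) [CommRing B]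
    (v : τ) : splitEquiv hi B (X v) = X (i v) := by
  simp [splitEquiv]

variable {K : 𝕀 → Type*} [∀ r, Field (K r)]

/-- For polynomials in the indeterminates in the image of `i`, internal polynomials in all
indeterminates may be replaced by internal polynomials in those of `i`, over the algebras of
polynomials in the others. -/
theorem internalize_comp_rename {V τ : Type*} {i : τ → V} (hi : Function.Injective i) :
    (internalize U K K V).comp (rename i : _ →ₐ[(U : Filter 𝕀).Product K] _).toRingHom =
      (ultraMap U fun r => (splitEquiv hi (K r)).toRingEquiv.toRingHom).comp
        (internalize U K (fun r => MvPolynomial ↥(Set.range i)ᶜ (K r)) τ) := by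
  refine MvPolynomial.ringHom_ext (fun a => ?_) fun v => ?_
  · obtain ⟨a, rfl⟩ := ultraMk_surjective U K a
    have e : (rename i : _ →ₐ[(U : Filter 𝕀).Product K] _).toRingHom (C (ultraMk U K a)) =
      C (ultraMk U K a) := rename_C _ _
    rw [RingHom.comp_apply, RingHom.comp_apply, e, internalize_C, internalize_C, ultraMap_ultraMk]
    congr 1
    funext r
    exact ((splitEquiv hi (K r)).commutes (a r)).symm
  · have e : (rename i : _ →ₐ[(U : Filter 𝕀).Product K] _).toRingHom (X v) = X (i v) :=
      rename_X _ _
    rw [RingHom.comp_apply, RingHom.comp_apply, e, internalize_X, internalize_X, ultraMap_ultraMk]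
    congr 1
    funext r
    exact (splitEquiv_X hi (K r) v).symm

theorem splitEquiv_bijective {V τ : Type*} {i : τ → V} (hi : Function.Injective i) :
    Function.Bijective (ultraMap U fun r => (splitEquiv hi (K r)).toRingEquiv.toRingHom) :=
  ultraMap_bijective fun r => (splitEquiv hi (K r)).bijective

theorem unpack_eq_internalize (m n : ℕ) : unpack U m n K = internalize U K K (ThetaX m n) :=
  rfl

/-- Finitely many polynomials involve only finitely many indeterminates. -/
theorem exists_rename_eq_of_finite {V k ι : Type*} [CommRing k] [Finite ι]
    (f : ι → MvPolynomial V k) :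
    ∃ (n : ℕ) (i : Fin n → V) (_ : Function.Injective i) (g : ι → MvPolynomial (Fin n) k),
      ∀ j, rename i (g j) = f j := by
  classical
  have := Fintype.ofFinite ι
  let Y : Finset V := Finset.univ.biUnion fun j => (f j).vars
  refine ⟨Y.card, fun a => (Y.equivFin.symm a : V),
    Subtype.val_injective.comp Y.equivFin.symm.injective, ?_⟩
  have h : ∀ j, ∃ g : MvPolynomial (Fin Y.card) k,
      rename (fun a => (Y.equivFin.symm a : V)) g = f j := fun j =>
    exists_rename_eq_of_vars_subset_range (f j) _
      (Subtype.val_injective.comp Y.equivFin.symm.injective) fun v hv => by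
        have hv : v ∈ Y := Finset.mem_biUnion.2 ⟨j, Finset.mem_univ _, hv⟩
        exact ⟨Y.equivFin ⟨v, hv⟩, by simp⟩
  choose g hg using h
  exact ⟨g, hg⟩

variable [∀ r, CharZero (K r)]

theorem internalize_comp_rename_faithfullyFlat {V : Type*} {n : ℕ} {i : Fin n → V}
    (hi : Function.Injective i) :
    ((internalize U K K V).comp
      (rename i : _ →ₐ[(U : Filter 𝕀).Product K] _).toRingHom).FaithfullyFlat := by
  rw [internalize_comp_rename hi]
  exact faithfullyFlat_comp (internalize_faithfullyFlat_fin n)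
    (RingHom.FaithfullyFlat.of_bijective (splitEquiv_bijective hi))

theorem internalize_faithfullyFlat (V : Type*) : (internalize U K K V).FaithfullyFlat := by
  refine faithfullyFlat_of_relations _ (fun l f x h => ?_) (fun l f x h => ?_)
  · obtain ⟨n, i, hi, g, hg⟩ := exists_rename_eq_of_finite f
    obtain ⟨k, a, y, hy, ha⟩ := exists_of_sum_mul_eq_zero
      (internalize_comp_rename_faithfullyFlat (U := U) (K := K) hi) (f := g) (x := x) (by
        rw [← h]
        exact Finset.sum_congr rfl fun j _ => by rw [← hg j]; rfl)
    refine ⟨Fin k, inferInstance, fun j l => rename i (a j l), y, hy, fun j => ?_⟩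
    rw [← map_zero (rename i : _ →ₐ[(U : Filter 𝕀).Product K] _), ← ha j, map_sum]
    exact Finset.sum_congr rfl fun l _ => by rw [map_mul, hg]
  · obtain ⟨n, i, hi, g, hg⟩ := exists_rename_eq_of_finite f
    have h1 : (1 : MvPolynomial (Fin n) ((U : Filter 𝕀).Product K)) ∈
        Ideal.span (Set.range g) := by
      rw [← map_mem_map_iff (internalize_comp_rename_faithfullyFlat (U := U) (K := K) hi),
        map_one, ← h]
      refine Ideal.sum_mem _ fun j _ => Ideal.mul_mem_right _ _ ?_
      rw [← hg j]
      exact Ideal.mem_map_of_mem _ (Ideal.subset_span ⟨j, rfl⟩)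
    obtain ⟨c, hc⟩ := Ideal.mem_span_range_iff_exists_fun.1 h1
    refine ⟨fun j => rename i (c j), ?_⟩
    rw [← map_one (rename i : _ →ₐ[(U : Filter 𝕀).Product K] _), ← hc, map_sum]
    exact Finset.sum_congr rfl fun l _ => by rw [map_mul, hg, mul_comm]

end Split

/-! ### Internal ideals and irreducible polynomials -/

section Internal

open MvPolynomial

variable {𝕀 : Type*} {U : Ultrafilter 𝕀}

/-- A finitely generated ideal of an ultraproduct is the ultraproduct of the ideals generated by
the coordinates of the generators. -/
theorem ultraMk_mem_span_range_iff {R : 𝕀 → Type*} [∀ r, CommRing (R r)] {ι : Type*} [Fintype ι]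
    {a : ι → ∀ r, R r} {x : ∀ r, R r} :
    ultraMk U R x ∈ Ideal.span (Set.range fun j => ultraMk U R (a j)) ↔
      ∀ᶠ r in (U : Filter 𝕀), x r ∈ Ideal.span (Set.range fun j => a j r) := by
  simp only [Ideal.mem_span_range_iff_exists_fun]
  constructor
  · rintro ⟨c, hc⟩
    choose c' hc' using fun j => ultraMk_surjective U R (c j)
    obtain rfl := funext hc'
    simp only [← map_mul, ← map_sum] at hc
    refine ((ultraMk_eq_iff U).1 hc).mono fun r hr => ⟨fun j => c' j r, ?_⟩
    simpa using hr
  · intro h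
    have h' : ∀ r, ∃ c : ι → R r, (∃ c : ι → R r, ∑ j, c j * a j r = x r) →
        ∑ j, c j * a j r = x r := fun r => by
      by_cases hr : ∃ c : ι → R r, ∑ j, c j * a j r = x r
      · exact ⟨hr.choose, fun _ => hr.choose_spec⟩
      · exact ⟨0, fun h => absurd h hr⟩
    choose c hc using h'
    refine ⟨fun j => ultraMk U R fun r => c r j, ?_⟩
    simp only [← map_mul, ← map_sum]
    refine (ultraMk_eq_iff U).2 (h.mono fun r hr => ?_)
    simpa using hc r hr

theorem ultraMk_isUnit_iff {R : 𝕀 → Type*} [∀ r, CommRing (R r)] {x : ∀ r, R r} :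
    IsUnit (ultraMk U R x) ↔ ∀ᶠ r in (U : Filter 𝕀), IsUnit (x r) := by
  have h := ultraMk_mem_span_range_iff (U := U) (ι := Unit) (a := fun _ => x) (x := 1)
  simpa [Set.range_const, ← Ideal.eq_top_iff_one, Ideal.span_singleton_eq_top, map_one] using h

theorem ultraMk_dvd_iff {R : 𝕀 → Type*} [∀ r, CommRing (R r)] {a x : ∀ r, R r} :
    ultraMk U R a ∣ ultraMk U R x ↔ ∀ᶠ r in (U : Filter 𝕀), a r ∣ x r := by
  have h := ultraMk_mem_span_range_iff (U := U) (ι := Unit) (a := fun _ => a) (x := x)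
  simpa [Set.range_const, Ideal.mem_span_singleton] using h

variable {K : 𝕀 → Type*}

theorem ultraMk_mem_map_span_range_iff [∀ r, CommRing (K r)] {B : 𝕀 → Type*} [∀ r, CommRing (B r)]
    [∀ r, Algebra (K r) (B r)] {σ ι : Type*} [Fintype ι] {p : ι → MvPolynomial σ (∀ r, K r)}
    {x : ∀ r, MvPolynomial σ (B r)} :
    ultraMk U (fun r => MvPolynomial σ (B r)) x ∈ (Ideal.span (Set.range fun j => map (ultraMk U K) (p j))).map
        (internalize U K B σ) ↔
      ∀ᶠ r in (U : Filter 𝕀), x r ∈ Ideal.span (Set.range fun j => coord B r (p j)) := by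
  have h : (Ideal.span (Set.range fun j => map (ultraMk U K) (p j))).map (internalize U K B σ) =
      Ideal.span (Set.range fun j =>
        ultraMk U (fun r => MvPolynomial σ (B r)) fun r => coord B r (p j)) := by
    refine (Ideal.map_span _ _).trans (congrArg Ideal.span ?_)
    refine (Set.range_comp (internalize U K B σ) fun j => map (ultraMk U K) (p j)).symm.trans ?_
    exact congrArg Set.range (_root_.funext fun j => internalize_map (p j))
  rw [h]
  exact ultraMk_mem_span_range_iff (R := fun r => MvPolynomial σ (B r))
    (a := fun j r => coord B r (p j))

/-- Internal polynomials in finitely many indeterminates of finite total degree are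
polynomials. -/
theorem exists_internalize_eq [∀ r, CommRing (K r)] {τ : Type*} [Finite τ]
    (x : ∀ r, MvPolynomial τ (K r)) (D : ℕ) (h : ∀ᶠ r in (U : Filter 𝕀), (x r).totalDegree ≤ D) :
    ∃ c, ultraMk U (fun r => MvPolynomial τ (K r)) x = internalize U K K τ c := by
  classical
  let s : Finset (τ →₀ ℕ) := (Finsupp.finite_of_degree_le (σ := τ) D).toFinset
  refine ⟨map (ultraMk U K) (∑ e ∈ s, monomial e fun r => coeff e (x r)), ?_⟩
  rw [internalize_map, ultraMk_eq_iff]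
  refine h.mono fun r hr => ?_
  ext e
  have : ∀ e : τ →₀ ℕ, coord K r (monomial e fun r => coeff e (x r)) =
    monomial e (coeff e (x r)) := fun e => map_monomial _ _ _
  simp only [map_sum, this, coeff_sum, coeff_monomial, Finset.sum_ite_eq']
  split_ifs with he
  · rfl
  · by_contra hne
    refine he ((Set.Finite.mem_toFinset _).2 ?_)
    exact (le_totalDegree (mem_support_iff.2 hne)).trans hr

/-- The coordinates of an irreducible polynomial over `∏_U K_r` are irreducible almost
everywhere. -/
theorem eventually_irreducible_coord [∀ r, Field (K r)] [∀ r, CharZero (K r)] {τ : Type*}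
    [Finite τ] {f : MvPolynomial τ (∀ r, K r)} (hf : Irreducible (map (ultraMk U K) f)) :
    ∀ᶠ r in (U : Filter 𝕀), Irreducible (coord K r f) := by
  have hφ := internalize_faithfullyFlat (U := U) (K := K) τ
  have isUnit_of : ∀ p, IsUnit (internalize U K K τ p) → IsUnit p := fun p hp => by
    rw [← Ideal.span_singleton_eq_top, Ideal.eq_top_iff_one, ← map_mem_map_iff hφ, map_one,
      Ideal.map_span, Set.image_singleton, ← Ideal.eq_top_iff_one, Ideal.span_singleton_eq_top]
    exact hp
  by_contra hirr
  rw [← Ultrafilter.eventually_not] at hirr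
  have hu : ∀ᶠ r in (U : Filter 𝕀), ¬ IsUnit (coord K r f) := by
    rw [Ultrafilter.eventually_not, ← ultraMk_isUnit_iff (U := U)]
    intro h
    rw [← internalize_map] at h
    exact hf.not_isUnit (isUnit_of _ h)
  have hne : ∀ᶠ r in (U : Filter 𝕀), coord K r f ≠ 0 := by
    rw [Ultrafilter.eventually_not, ← ultraMk_eq_zero_iff (U := U), ← internalize_map]
    exact fun h => hf.ne_zero (hφ.injective (h.trans (map_zero _).symm))
  have hab : ∀ r, ∃ a b : MvPolynomial τ (K r), ¬ Irreducible (coord K r f) →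
      ¬ IsUnit (coord K r f) → coord K r f = a * b ∧ ¬ IsUnit a ∧ ¬ IsUnit b := fun r => by
    by_cases h : Irreducible (coord K r f)
    · exact ⟨0, 0, fun h' => absurd h h'⟩
    · by_cases h' : IsUnit (coord K r f)
      · exact ⟨0, 0, fun _ h'' => absurd h' h''⟩
      · rw [irreducible_iff] at h
        push Not at h
        obtain ⟨a, b, h⟩ := h h'
        exact ⟨a, b, fun _ _ => h⟩
  choose a b hab using hab
  have hev : ∀ᶠ r in (U : Filter 𝕀), coord K r f = a r * b r ∧ ¬ IsUnit (a r) ∧ ¬ IsUnit (b r) ∧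
      (a r).totalDegree ≤ f.totalDegree ∧ (b r).totalDegree ≤ f.totalDegree := by
    filter_upwards [hirr, hu, hne] with r h₁ h₂ h₃
    obtain ⟨h, ha, hb⟩ := hab r h₁ h₂
    rw [h] at h₃
    have hd : (coord K r f).totalDegree ≤ f.totalDegree := Finset.sup_mono (support_map_subset _ _)
    rw [h, totalDegree_mul_of_isDomain (left_ne_zero_of_mul h₃) (right_ne_zero_of_mul h₃)] at hd
    exact ⟨h, ha, hb, by omega, by omega⟩
  obtain ⟨a', ha'⟩ := exists_internalize_eq (U := U) a _ (hev.mono fun r h => h.2.2.2.1)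
  obtain ⟨b', hb'⟩ := exists_internalize_eq (U := U) b _ (hev.mono fun r h => h.2.2.2.2)
  have hfab : map (ultraMk U K) f = a' * b' := hφ.injective (by
    rw [internalize_map, map_mul, ← ha', ← hb', ← map_mul]
    exact (ultraMk_eq_iff U).2 (hev.mono fun r h => h.1))
  rcases hf.isUnit_or_isUnit hfab with h | h
  · have := h.map (internalize U K K τ)
    rw [← ha', ultraMk_isUnit_iff] at this
    obtain ⟨r, h₁, h₂⟩ := (this.and hev).exists
    exact h₂.2.1 h₁
  · have := h.map (internalize U K K τ)
    rw [← hb', ultraMk_isUnit_iff] at this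
    obtain ⟨r, h₁, h₂⟩ := (this.and hev).exists
    exact h₂.2.2.1 h₁

/-- An irreducible polynomial remains prime when further indeterminates are adjoined to the
coefficients. -/
theorem prime_map_C {k τ ω : Type*} [Field k] {f : MvPolynomial τ k} (hf : Irreducible f) :
    Prime (map (C : k →+* MvPolynomial ω k) f) := by
  have h : Prime (C f : MvPolynomial ω (MvPolynomial τ k)) :=
    (prime_C_iff ω).2 (UniqueFactorizationMonoid.irreducible_iff_prime.1 hf)
  rw [← MulEquiv.prime_iff (commAlgEquiv k ω τ).toMulEquiv] at h
  convert h using 1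
  exact (commAlgEquiv_C f).symm

end Internal

/-! ### Affine varieties as hypersurfaces, birationally -/

section Hypersurface

open Polynomial

/-- The primitive element theorem for a finite extension of domains, with denominators cleared. -/
theorem exists_primitive_element_of_finite {A E : Type*} [CommRing A] [IsDomain A] [CharZero A]
    [CommRing E] [IsDomain E] [Algebra A E] [FaithfulSMul A E] [Module.Finite A E] :
    ∃ e : E, ∀ y : E, ∃ (c : A) (q : A[X]), c ≠ 0 ∧ c • y = aeval e q := by
  let F := FractionRing A
  let L := FractionRing E
  let : Algebra F L := FractionRing.liftAlgebra A L
  have : IsScalarTower A F L := FractionRing.isScalarTower_liftAlgebra A L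
  have : Module.Finite F L := Module.Finite.of_isLocalization A E (nonZeroDivisors A)
  have : CharZero F := charZero_of_injective_algebraMap (IsFractionRing.injective A F)
  obtain ⟨θ, hθ⟩ := Field.exists_primitive_element F L
  obtain ⟨x, y, hy, rfl⟩ := IsFractionRing.div_surjective (A := E) θ
  obtain ⟨e, a, ha, hae⟩ := (Algebra.IsAlgebraic.isAlgebraic (R := A) y).exists_smul_eq_mul x hy
  have haF : algebraMap A F a ≠ 0 := by
    rwa [Ne, FaithfulSMul.algebraMap_eq_zero_iff]
  have hyL : algebraMap E L y ≠ 0 := by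
    rw [Ne, FaithfulSMul.algebraMap_eq_zero_iff]
    exact nonZeroDivisors.ne_zero hy
  have he : algebraMap E L e = algebraMap F L (algebraMap A F a) *
      (algebraMap E L x / algebraMap E L y) := by
    have := congrArg (algebraMap E L) hae
    rw [Algebra.smul_def, map_mul, map_mul, ← IsScalarTower.algebraMap_apply A E L,
      IsScalarTower.algebraMap_apply A F L] at this
    rw [← mul_div_assoc, this, mul_div_cancel_left₀ _ hyL]
  have htop : IntermediateField.adjoin F {algebraMap E L e} = ⊤ := by
    rw [← top_le_iff, ← hθ, IntermediateField.adjoin_simple_le_iff]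
    have h₁ := IntermediateField.mem_adjoin_simple_self F (algebraMap E L e)
    have h₂ : algebraMap E L x / algebraMap E L y =
        algebraMap F L (algebraMap A F a)⁻¹ * algebraMap E L e := by
      rw [he, ← mul_assoc, ← map_mul, inv_mul_cancel₀ haF, map_one, one_mul]
    rw [h₂]
    exact mul_mem (IntermediateField.algebraMap_mem _ _) h₁
  refine ⟨e, fun z => ?_⟩
  have hz : algebraMap E L z ∈ Algebra.adjoin F {algebraMap E L e} := by
    rw [← IntermediateField.adjoin_simple_toSubalgebra_of_isAlgebraic
      (Algebra.IsAlgebraic.isAlgebraic _), htop]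
    exact Algebra.mem_top
  rw [Algebra.adjoin_singleton_eq_range_aeval] at hz
  obtain ⟨p, hp⟩ := hz
  obtain ⟨c, hc, hcp⟩ := IsLocalization.integerNormalization_spec (nonZeroDivisors A) p
  refine ⟨c, IsLocalization.integerNormalization (nonZeroDivisors A) p,
    nonZeroDivisors.ne_zero hc, FaithfulSMul.algebraMap_injective E L ?_⟩
  have hp' : aeval (algebraMap E L e) p = algebraMap E L z := hp
  rw [← aeval_algebraMap_apply, ← aeval_map_algebraMap F, hcp, ← algebraMap_smul F c p,
    map_smul (aeval (algebraMap E L e) : F[X] →ₐ[F] L), hp', Algebra.smul_def, Algebra.smul_def, map_mul,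
    ← IsScalarTower.algebraMap_apply A E L, ← IsScalarTower.algebraMap_apply A F L]

open MvPolynomial in
theorem exists_hypersurface_of_surjective {k σ E : Type*} [Field k] [CharZero k] [Finite σ]
    [CommRing E] [IsDomain E] [Algebra k E] (π : MvPolynomial σ k →ₐ[k] E)
    (hπ : Function.Surjective π) :
    ∃ (d : ℕ) (ψ : MvPolynomial (Fin (d + 1)) k →ₐ[k] MvPolynomial σ k)
      (f s : MvPolynomial (Fin (d + 1)) k) (b : σ → MvPolynomial (Fin (d + 1)) k),
      Irreducible f ∧ (∀ p, π (ψ p) = 0 ↔ f ∣ p) ∧ ¬ f ∣ s ∧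
        ∀ v, π (ψ s * MvPolynomial.X v - ψ (b v)) = 0 := by
  have : Algebra.FiniteType k E := Algebra.FiniteType.of_surjective π hπ
  obtain ⟨d, g, hg, hfin⟩ := exists_finite_inj_algHom_of_fg k E
  let := g.toRingHom.toAlgebra
  have : Module.Finite (MvPolynomial (Fin d) k) E := hfin
  have : FaithfulSMul (MvPolynomial (Fin d) k) E :=
    (faithfulSMul_iff_algebraMap_injective _ _).2 hg
  obtain ⟨e, he⟩ := exists_primitive_element_of_finite (A := MvPolynomial (Fin d) k) (E := E)
  choose c q hc hq using he
  choose t ht using fun i => hπ (g (MvPolynomial.X i))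
  obtain ⟨e', rfl⟩ := hπ e
  let Φ := finSuccEquiv k d
  let ψ : MvPolynomial (Fin (d + 1)) k →ₐ[k] MvPolynomial σ k :=
    MvPolynomial.aeval (Fin.cons e' t)
  have hψ : ∀ p, π (ψ p) = Polynomial.aeval (π e') (Φ p) := by
    intro p
    induction p using MvPolynomial.induction_on with
    | C a =>
      simp only [ψ, Φ, MvPolynomial.aeval_C, finSuccEquiv_apply, eval₂Hom_C]
      simp
      exact (g.commutes a).symm
    | add p q hp hq => simp only [map_add, hp, hq]
    | mul_X p i hp =>
      rw [map_mul, map_mul, hp, map_mul, map_mul]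
      congr 1
      refine Fin.cases ?_ (fun i => ?_) i
      · simp [ψ, Φ, finSuccEquiv_X_zero]
      · simp [ψ, Φ, finSuccEquiv_X_succ, ht]
        rfl
  have hint : IsIntegral (MvPolynomial (Fin d) k) (π e') :=
    Algebra.IsIntegral.isIntegral _
  have hprime := minpoly.prime_of_isIntegrallyClosed hint
  let μ := minpoly (MvPolynomial (Fin d) k) (π e')
  have hf : Irreducible (Φ.symm μ) := by
    rw [MulEquiv.irreducible_iff Φ.symm]
    exact hprime.irreducible
  have hdvd : ∀ p, π (ψ p) = 0 ↔ Φ.symm μ ∣ p := fun p => by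
    rw [hψ, minpoly.isIntegrallyClosed_dvd_iff hint,
      ← map_dvd_iff Φ, Φ.apply_symm_apply]
  have := Fintype.ofFinite σ
  -- A common denominator of the classes of the indeterminates.
  let C' : MvPolynomial (Fin d) k := ∏ v, c (π (MvPolynomial.X v))
  have hC' : C' ≠ 0 := Finset.prod_ne_zero_iff.2 fun v _ => hc _
  have hC'v : ∀ v, ∃ c', C' = c' * c (π (MvPolynomial.X v)) := fun v => by
    obtain ⟨c', h⟩ := Finset.dvd_prod_of_mem
      (fun v => c (π (MvPolynomial.X v))) (Finset.mem_univ v)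
    exact ⟨c', h.trans (mul_comm _ _)⟩
  choose c' hc' using hC'v
  refine ⟨d, ψ, Φ.symm μ, Φ.symm (Polynomial.C C'), fun v => Φ.symm (Polynomial.C (c' v) *
    q (π (MvPolynomial.X v))), hf, hdvd, ?_, fun v => ?_⟩
  · rw [← hdvd, hψ, Φ.apply_symm_apply, Polynomial.aeval_C,
      FaithfulSMul.algebraMap_eq_zero_iff]
    exact hC'
  · rw [map_sub, map_mul, hψ, hψ, Φ.apply_symm_apply,
      Φ.apply_symm_apply, Polynomial.aeval_C, map_mul, Polynomial.aeval_C, ← hq, sub_eq_zero,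
      hc' v, map_mul, mul_assoc, Algebra.smul_def]

/-- Over a field of characteristic zero, the variety of a prime ideal `P` is birational to an
irreducible hypersurface `f = 0`: there is a homomorphism `ψ` that induces an injection of
`k[t] / f` into `k[σ] / P`, and the classes of the indeterminates are fractions `b v / s`. -/
theorem exists_hypersurface {k σ : Type*} [Field k] [CharZero k] [Finite σ]
    (P : Ideal (MvPolynomial σ k)) [P.IsPrime] :
    ∃ (d : ℕ) (ψ : MvPolynomial (Fin (d + 1)) k →ₐ[k] MvPolynomial σ k)
      (f s : MvPolynomial (Fin (d + 1)) k) (b : σ → MvPolynomial (Fin (d + 1)) k),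
      Irreducible f ∧ (∀ p, ψ p ∈ P ↔ f ∣ p) ∧ ¬ f ∣ s ∧
        ∀ v, ψ s * MvPolynomial.X v - ψ (b v) ∈ P := by
  simpa only [Ideal.Quotient.mkₐ_eq_mk, Ideal.Quotient.eq_zero_iff_mem] using
    exists_hypersurface_of_surjective (Ideal.Quotient.mkₐ k P) (Ideal.Quotient.mkₐ_surjective k P)

end Hypersurface

/-! ### Extensions of prime ideals -/

section Prime

open MvPolynomial

/-- If the classes of the indeterminates modulo `J` are fractions `b v / s` of elements coming
from `A`, then each polynomial is, up to a power of `s`, congruent to an element coming from `A`;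
`χ` is a compatible homomorphism into another ring. -/
theorem exists_pow_mul_sub_mem {k A L σ : Type*} [CommRing k] [CommRing A] [CommRing L]
    (ψ : A →+* MvPolynomial σ k) (J : Ideal (MvPolynomial σ k)) (s : A) (b : σ → A)
    (l : A →+* L) (χ : MvPolynomial σ k →+* L)
    (hC : ∀ c, ∃ a, ψ a = C c ∧ l a = χ (C c))
    (hX : ∀ v, ψ s * X v - ψ (b v) ∈ J ∧ l s * χ (X v) = l (b v)) (g : MvPolynomial σ k) :
    ∃ N q, ψ s ^ N * g - ψ q ∈ J ∧ l s ^ N * χ g = l q := by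
  induction g using MvPolynomial.induction_on with
  | C c =>
    obtain ⟨a, h₁, h₂⟩ := hC c
    exact ⟨0, a, by simp [h₁], by simp [h₂]⟩
  | add p p' hp hp' =>
    obtain ⟨N, q, h₁, h₂⟩ := hp
    obtain ⟨N', q', h₁', h₂'⟩ := hp'
    refine ⟨N + N', s ^ N' * q + s ^ N * q', ?_, ?_⟩
    · have : ψ s ^ (N + N') * (p + p') - ψ (s ^ N' * q + s ^ N * q') =
          ψ s ^ N' * (ψ s ^ N * p - ψ q) + ψ s ^ N * (ψ s ^ N' * p' - ψ q') := by
        simp only [map_add, map_mul, map_pow]; ring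
      rw [this]
      exact J.add_mem (J.mul_mem_left _ h₁) (J.mul_mem_left _ h₁')
    · simp only [map_add, map_mul, map_pow, ← h₂, ← h₂']; ring
  | mul_X p v hp =>
    obtain ⟨N, q, h₁, h₂⟩ := hp
    obtain ⟨h₃, h₄⟩ := hX v
    refine ⟨N + 1, q * b v, ?_, ?_⟩
    · have : ψ s ^ (N + 1) * (p * X v) - ψ (q * b v) =
          (ψ s * X v) * (ψ s ^ N * p - ψ q) + ψ q * (ψ s * X v - ψ (b v)) := by
        simp only [map_mul]; ring
      rw [this]
      exact J.add_mem (J.mul_mem_left _ h₁) (J.mul_mem_left _ h₃)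
    · simp only [map_mul, ← h₂, ← h₄]; ring

variable {𝕀 : Type*} {U : Ultrafilter 𝕀} {K : 𝕀 → Type*} {B : 𝕀 → Type*}
variable [∀ r, Field (K r)] [∀ r, CommRing (B r)] [∀ r, Algebra (K r) (B r)]

theorem coord_bind₁ {σ τ : Type*} (w : τ → MvPolynomial σ (∀ r, K r))
    (p : MvPolynomial τ (∀ r, K r)) (r : 𝕀) :
    coord B r (bind₁ w p) = bind₁ (fun i => coord B r (w i)) (coord B r p) :=
  map_bind₁ _ _ _

theorem isNoetherianRing_ultraproduct_mvPolynomial (σ : Type*) [Finite σ] :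
    IsNoetherianRing (MvPolynomial σ ((U : Filter 𝕀).Product K)) := by
  let := ultraField (U := U) K
  infer_instance

variable [∀ r, CharZero (K r)] [∀ r, Nontrivial (B r)]

/-- Let `P` be birational to the hypersurface `f = 0`, through the substitution `w` and the fractions
`b v / s`, and let the coordinate rings of the hypersurfaces `f(r) = 0` over `B r` embed into fields
`L r`. Then `P` generates the kernel of the homomorphism from internal polynomials to the
ultraproduct of the `L r` given by `X v ↦ b v / s`. -/
theorem isPrime_map_of_hypersurface {n : ℕ} {τ : Type*}
    (P : Ideal (MvPolynomial (Fin n) ((U : Filter 𝕀).Product K))) [P.IsPrime]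
    (hτ : (internalize U K B τ).FaithfullyFlat)
    (w : τ → MvPolynomial (Fin n) (∀ r, K r)) (f s : MvPolynomial τ (∀ r, K r))
    (b : Fin n → MvPolynomial τ (∀ r, K r))
    (hf : ∀ p : MvPolynomial τ (∀ r, K r), map (ultraMk U K) (bind₁ w p) ∈ P ↔
      map (ultraMk U K) f ∣ map (ultraMk U K) p)
    (hs : ¬ map (ultraMk U K) f ∣ map (ultraMk U K) s)
    (hb : ∀ v, map (ultraMk U K) (bind₁ w s * X v - bind₁ w (b v)) ∈ P)
    {L : 𝕀 → Type*} [∀ r, Field (L r)] (ι : ∀ r, MvPolynomial τ (B r) →+* L r)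
    (hι : ∀ᶠ r in (U : Filter 𝕀), ∀ x, ι r x = 0 ↔ coord B r f ∣ x) :
    (P.map (internalize U K B (Fin n))).IsPrime := by
  have hφ := internalize_faithfullyFlat_fin (U := U) (K := K) (B := B) n
  let χ : ∀ r, MvPolynomial (Fin n) (B r) →+* L r := fun r =>
    eval₂Hom ((ι r).comp C) fun v => (ι r (coord B r s))⁻¹ * ι r (coord B r (b v))
  let X' := ultraMap U χ
  let l := (ultraMap U ι).comp (internalize U K B τ)
  have hl_map : ∀ p, l (map (ultraMk U K) p) = ultraMk U L fun r => ι r (coord B r p) := fun p => by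
    simp only [l, RingHom.comp_apply, internalize_map, ultraMap_ultraMk]
  have hX_map : ∀ p, X' (internalize U K B (Fin n) (map (ultraMk U K) p)) =
      ultraMk U L fun r => χ r (coord B r p) := fun p => by
    simp only [X', internalize_map, ultraMap_ultraMk]
  have hl : ∀ p, l (map (ultraMk U K) p) = 0 ↔ map (ultraMk U K) f ∣ map (ultraMk U K) p := by
    intro p
    rw [hl_map, ultraMk_eq_zero_iff, ← Ideal.mem_span_singleton, ← map_mem_map_iff hτ,
      Ideal.map_span, Set.image_singleton, Ideal.mem_span_singleton, internalize_map,
      internalize_map, ultraMk_dvd_iff]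
    refine Filter.eventually_congr (hι.mono fun r hr => hr _)
  have hs0 : ∀ᶠ r in (U : Filter 𝕀), ι r (coord B r s) ≠ 0 := by
    rw [Ultrafilter.eventually_not, ← ultraMk_eq_zero_iff (U := U), ← hl_map, hl]
    exact hs
  have hls : l (map (ultraMk U K) s) ≠ 0 := fun h => hs ((hl s).1 h)
  have hmapbind : ∀ p, map (ultraMk U K) (bind₁ w p) =
      bind₁ (fun i => map (ultraMk U K) (w i)) (map (ultraMk U K) p) := fun p => map_bind₁ _ _ _
  have hker : P.map (internalize U K B (Fin n)) = RingHom.ker X' := by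
    apply le_antisymm
    · refine Ideal.map_le_iff_le_comap.2 fun p hp => ?_
      obtain ⟨N, q, h₁, h₂⟩ := exists_pow_mul_sub_mem
        (bind₁ fun i => map (ultraMk U K) (w i)).toRingHom P (map (ultraMk U K) s)
        (fun v => map (ultraMk U K) (b v)) l (X'.comp (internalize U K B (Fin n)))
        (fun c => ⟨C c, bind₁_C_right _ c, by
          obtain ⟨c, rfl⟩ := ultraMk_surjective U K c
          simp only [l, X', RingHom.comp_apply, internalize_C, ultraMap_ultraMk]
          congr 1
          funext r
          exact (eval₂_C ((ι r).comp C) _ _).symm⟩)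
        (fun v => ⟨by
          have := hb v
          rwa [map_sub, map_mul, hmapbind, hmapbind, map_X] at this, by
          rw [hl_map, hl_map, RingHom.comp_apply, ← map_X (ultraMk U K), hX_map, ← map_mul,
            ultraMk_eq_iff]
          refine hs0.mono fun r hr => ?_
          have e : χ r (coord (K := K) B r (X v)) =
            (ι r (coord B r s))⁻¹ * ι r (coord B r (b v)) := by
            have : coord (K := K) B r (X v : MvPolynomial (Fin n) (∀ r, K r)) = X v := map_X _ _
            rw [this]
            exact eval₂_X _ _ _
          change ι r (coord B r s) * χ r (coord (K := K) B r (X v)) = _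
          rw [e, mul_inv_cancel_left₀ hr]⟩) p
      obtain ⟨q, rfl⟩ := exists_lift q
      have hq : map (ultraMk U K) (bind₁ w q) ∈ P := by
        rw [hmapbind]
        exact (P.sub_mem_iff_right (P.mul_mem_left _ hp)).1 h₁
      rw [(hl q).2 ((hf q).1 hq)] at h₂
      exact (mul_eq_zero.1 h₂).resolve_left (pow_ne_zero _ hls)
    · intro g hg
      obtain ⟨g, rfl⟩ := ultraMk_surjective U _ g
      obtain ⟨N, p, hp⟩ := Submodule.fg_iff_exists_fin_generating_family.1
        ((isNoetherianRing_ultraproduct_mvPolynomial (U := U) (K := K) (Fin n)).noetherian P)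
      choose p' hp' using fun j => exists_lift (p j)
      obtain rfl : (fun j => map (ultraMk U K) (p' j)) = p := _root_.funext hp'
      have hP : P = Ideal.span (Set.range fun j => map (ultraMk U K) (p' j)) := hp.symm
      have hmem : ∀ x : ∀ r, MvPolynomial (Fin n) (B r),
          ultraMk U _ x ∈ P.map (internalize U K B (Fin n)) ↔
          ∀ᶠ r in (U : Filter 𝕀), x r ∈ Ideal.span (Set.range fun j => coord B r (p' j)) := by
        intro x
        rw [hP]
        exact ultraMk_mem_map_span_range_iff
      have hcoord : ∀ p, map (ultraMk U K) p ∈ P → ∀ᶠ r in (U : Filter 𝕀),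
          coord B r p ∈ Ideal.span (Set.range fun j => coord B r (p' j)) := by
        intro p hp
        rw [← hmem, ← internalize_map]
        exact Ideal.mem_map_of_mem _ hp
      -- The denominator `s` is a nonzerodivisor modulo `P`, hence by flatness modulo its extension
      -- and modulo almost all coordinates of it, with all its powers, internal ones included.
      have hnzd : ∀ᶠ r in (U : Filter 𝕀), ∀ x, coord B r (bind₁ w s) * x ∈
          Ideal.span (Set.range fun j => coord B r (p' j)) →
          x ∈ Ideal.span (Set.range fun j => coord B r (p' j)) := by
        by_contra h
        rw [← Ultrafilter.eventually_not] at h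
        have hx : ∀ r, ∃ x, (¬ ∀ x, coord B r (bind₁ w s) * x ∈
            Ideal.span (Set.range fun j => coord B r (p' j)) →
            x ∈ Ideal.span (Set.range fun j => coord B r (p' j))) →
            coord B r (bind₁ w s) * x ∈ Ideal.span (Set.range fun j => coord B r (p' j)) ∧
            x ∉ Ideal.span (Set.range fun j => coord B r (p' j)) := fun r => by
          by_cases hr : ∀ x, coord B r (bind₁ w s) * x ∈
            Ideal.span (Set.range fun j => coord B r (p' j)) →
            x ∈ Ideal.span (Set.range fun j => coord B r (p' j))
          · exact ⟨0, fun h => absurd hr h⟩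
          · have hr' := hr
            push Not at hr'
            exact ⟨hr'.choose, fun _ => hr'.choose_spec⟩
        choose x hx using hx
        have h₁ : internalize U K B (Fin n) (map (ultraMk U K) (bind₁ w s)) * ultraMk U _ x ∈
            P.map (internalize U K B (Fin n)) := by
          rw [internalize_map, ← map_mul, hmem]
          exact h.mono fun r hr => (hx r hr).1
        have hsP : map (ultraMk U K) (bind₁ w s) ∉ P := fun h => hs ((hf s).1 h)
        have h₂ := mem_map_of_mul_mem_map hφ
          (fun a ha => (Ideal.IsPrime.mem_or_mem ‹_› ha).resolve_left hsP) h₁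
        rw [hmem] at h₂
        obtain ⟨r, h₃, h₄⟩ := (h₂.and h).exists
        exact (hx r h₄).2 h₃
      rw [hmem]
      have hg' : ∀ᶠ r in (U : Filter 𝕀), χ r (g r) = 0 := by
        rw [← ultraMk_eq_zero_iff (U := U)]
        exact hg
      have hbr : ∀ᶠ r in (U : Filter 𝕀), ∀ v, coord B r (bind₁ w s * X v - bind₁ w (b v)) ∈
          Ideal.span (Set.range fun j => coord B r (p' j)) :=
        Filter.eventually_all.2 fun v => hcoord _ (hb v)
      filter_upwards [hι, hs0, hg', hbr, hcoord _ ((hf f).2 dvd_rfl), hnzd] with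
        r h₁ h₂ h₃ h₄ h₅ h₆
      simp only [coord_bind₁] at h₅ h₆
      obtain ⟨M, q, h₇, h₈⟩ := exists_pow_mul_sub_mem
        (bind₁ fun i => coord B r (w i)).toRingHom
        (Ideal.span (Set.range fun j => coord B r (p' j))) (coord B r s)
        (fun v => coord B r (b v)) (ι r) (χ r)
        (fun c => ⟨C c, bind₁_C_right _ c, (eval₂_C ((ι r).comp C) _ _).symm⟩)
        (fun v => ⟨by
          have := h₄ v
          have e : coord (K := K) B r (X v : MvPolynomial (Fin n) (∀ r, K r)) = X v := map_X _ _
          rwa [map_sub, map_mul, coord_bind₁, coord_bind₁, e] at this, by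
          have e : χ r (X v) = (ι r (coord B r s))⁻¹ * ι r (coord B r (b v)) := eval₂_X _ _ _
          rw [e, mul_inv_cancel_left₀ h₂]⟩) (g r)
      rw [h₃, mul_zero, eq_comm, h₁] at h₈
      have hq : bind₁ (fun i => coord B r (w i)) q ∈
          Ideal.span (Set.range fun j => coord B r (p' j)) :=
        Ideal.mem_of_dvd _ (map_dvd _ h₈) h₅
      have hsg : bind₁ (fun i => coord B r (w i)) (coord B r s) ^ M * g r ∈
          Ideal.span (Set.range fun j => coord B r (p' j)) :=
        (Submodule.sub_mem_iff_left _ hq).1 h₇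
      clear h₇ h₈
      induction M with
      | zero => simpa using hsg
      | succ M ih =>
        rw [pow_succ', mul_assoc] at hsg
        exact ih (h₆ _ hsg)
  rw [hker]
  exact RingHom.ker_isPrime X'

end Prime

section PrimeExtension

open MvPolynomial

variable {𝕀 : Type*} {U : Ultrafilter 𝕀} {K : 𝕀 → Type*} [∀ r, Field (K r)] [∀ r, CharZero (K r)]

/-- Prime ideals in finitely many indeterminates generate prime ideals of internal polynomials over
algebras `B r` in which irreducible polynomials over `K r` are prime. -/
theorem isPrime_map_internalize_fin {B : 𝕀 → Type*} [∀ r, CommRing (B r)]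
    [∀ r, Algebra (K r) (B r)] [∀ r, Nontrivial (B r)]
    (hB : ∀ (r : 𝕀) (d : ℕ) (f : MvPolynomial (Fin d) (K r)), Irreducible f →
      Prime (map (algebraMap (K r) (B r)) f)) {n : ℕ}
    (P : Ideal (MvPolynomial (Fin n) ((U : Filter 𝕀).Product K))) [P.IsPrime] :
    (P.map (internalize U K B (Fin n))).IsPrime := by
  let := ultraField (U := U) K
  obtain ⟨d, ψ, f, s, b, hf, hψ, hs, hb⟩ := exists_hypersurface P
  choose w hw using fun i => exists_lift (ψ (X i))
  obtain ⟨f, rfl⟩ := exists_lift f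
  obtain ⟨s, rfl⟩ := exists_lift s
  choose b' hb' using fun v => exists_lift (b v)
  obtain rfl : (fun v => map (ultraMk U K) (b' v)) = b := _root_.funext hb'
  have hψw : ∀ p, map (ultraMk U K) (bind₁ w p) = ψ (map (ultraMk U K) p) := fun p => by
    rw [map_bind₁]
    simp only [hw]
    exact (DFunLike.congr_fun (aeval_unique ψ) _).symm
  -- The coordinates of `f` are made irreducible everywhere, to have function fields everywhere.
  classical
  let F : ∀ r, MvPolynomial (Fin (d + 1)) (K r) := fun r =>
    if Irreducible (coord K r f) then coord K r f else X 0
  have hF : ∀ r, Irreducible (F r) := fun r => by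
    by_cases h : Irreducible (coord K r f)
    · simpa only [F, if_pos h] using h
    · simp only [F, if_neg h]
      rw [← MulEquiv.irreducible_iff (finSuccEquiv (K r) d), finSuccEquiv_X_zero]
      exact Polynomial.irreducible_X
  have hFB : ∀ r, (Ideal.span {map (algebraMap (K r) (B r)) (F r)}).IsPrime := fun r =>
    (Ideal.span_singleton_prime (hB r _ _ (hF r)).ne_zero).2 (hB r _ _ (hF r))
  have : ∀ r, IsDomain (MvPolynomial (Fin (d + 1)) (B r) ⧸
    Ideal.span {map (algebraMap (K r) (B r)) (F r)}) := fun r => Ideal.Quotient.isDomain _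
  refine isPrime_map_of_hypersurface P (internalize_faithfullyFlat_fin _) w f s b'
    (fun p => by rw [hψw, hψ]) hs
    (fun v => by rw [map_sub, map_mul, map_X, hψw, hψw]; exact hb v)
    (L := fun r => FractionRing (MvPolynomial (Fin (d + 1)) (B r) ⧸
      Ideal.span {map (algebraMap (K r) (B r)) (F r)}))
    (fun r => (algebraMap (MvPolynomial (Fin (d + 1)) (B r) ⧸
      Ideal.span {map (algebraMap (K r) (B r)) (F r)}) _).comp (Ideal.Quotient.mk _)) ?_
  refine (eventually_irreducible_coord hf).mono fun r hr x => ?_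
  have e : map (algebraMap (K r) (B r)) (F r) = coord B r f := by
    simp only [F, if_pos hr]
    exact map_map _ _ _
  rw [RingHom.comp_apply, FaithfulSMul.algebraMap_eq_zero_iff, Ideal.Quotient.eq_zero_iff_mem,
    Ideal.mem_span_singleton, e]

/-- The ideal generated by a prime ideal `P` is the directed union of the prime ideals generated
by finitely generated subideals of `P`, its traces on finitely many indeterminates. -/
theorem exists_fg_isPrime_map {V : Type*} (P : Ideal (MvPolynomial V ((U : Filter 𝕀).Product K)))
    [P.IsPrime] {z : (U : Filter 𝕀).Product fun r => MvPolynomial V (K r)}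
    (hz : z ∈ P.map (internalize U K K V)) :
    ∃ Q ≤ P, Q.FG ∧ (Q.map (internalize U K K V)).IsPrime ∧ z ∈ Q.map (internalize U K K V) := by
  obtain ⟨l, c, g, hg⟩ := Submodule.mem_span_set'.1 hz
  choose f hf hfg using fun j => (g j).2
  obtain ⟨n, i, hi, f', hf'⟩ := exists_rename_eq_of_finite f
  let ρ := (rename i : _ →ₐ[(U : Filter 𝕀).Product K] _).toRingHom
  have hρ : ∀ j, ρ (f' j) = f j := hf'
  refine ⟨(P.comap ρ).map ρ, Ideal.map_comap_le, ?_, ?_, ?_⟩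
  · exact Ideal.FG.map ((isNoetherianRing_ultraproduct_mvPolynomial (U := U) (K := K)
      (Fin n)).noetherian (P.comap ρ)) ρ
  · have h := isPrime_map_internalize_fin (B := fun r => MvPolynomial ↥(Set.range i)ᶜ (K r))
      (fun r d f hf => prime_map_C hf) (P.comap ρ)
    rw [Ideal.map_map, internalize_comp_rename hi, ← Ideal.map_map]
    exact Ideal.map_isPrime_of_equiv (RingEquiv.ofBijective _ (splitEquiv_bijective hi))
  · rw [← hg]
    refine Ideal.sum_mem _ fun j _ => Ideal.mul_mem_left _ _ ?_
    rw [← hfg, ← hρ]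
    refine Ideal.mem_map_of_mem _ (Ideal.mem_map_of_mem _ ?_)
    rw [Ideal.mem_comap, hρ]
    exact hf j

theorem isPrime_map_internalize {V : Type*}
    (P : Ideal (MvPolynomial V ((U : Filter 𝕀).Product K))) [hP : P.IsPrime] :
    (P.map (internalize U K K V)).IsPrime := by
  refine Ideal.isPrime_iff.2 ⟨fun h => hP.ne_top ?_, fun {x y} hxy => ?_⟩
  · rw [← comap_map_of_faithfullyFlat (internalize_faithfullyFlat V) P, h, Ideal.comap_top]
  · obtain ⟨Q, hQP, -, hQ, hxyQ⟩ := exists_fg_isPrime_map P hxy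
    exact (hQ.mem_or_mem hxyQ).imp (fun h => Ideal.map_mono hQP h) fun h => Ideal.map_mono hQP h

theorem ultraPow_ultraMk {R : 𝕀 → Type*} [∀ r, CommRing (R r)] (a : ∀ r, R r) (N : 𝕀 → ℕ) :
    ultraPow U (ultraMk U R a) (N : (U : Filter 𝕀).Germ ℕ) = ultraMk U R fun r => a r ^ N r := rfl

/-- The extension of a prime ideal is radical with respect to internal powers. -/
theorem mem_map_of_ultraPow_mem_map {V : Type*}
    (P : Ideal (MvPolynomial V ((U : Filter 𝕀).Product K))) [P.IsPrime]
    {x : (U : Filter 𝕀).Product fun r => MvPolynomial V (K r)} {N : (U : Filter 𝕀).Germ ℕ}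
    (h : ultraPow U x N ∈ P.map (internalize U K K V)) : x ∈ P.map (internalize U K K V) := by
  obtain ⟨Q, hQP, hfg, hQ, hxQ⟩ := exists_fg_isPrime_map P h
  refine Ideal.map_mono hQP ?_
  obtain ⟨a, rfl⟩ := ultraMk_surjective U _ x
  induction N using Filter.Germ.inductionOn with | h N => ?_
  rw [ultraPow_ultraMk] at hxQ
  obtain ⟨l, p, hp⟩ := Submodule.fg_iff_exists_fin_generating_family.1 hfg
  choose p' hp' using fun j => exists_lift (p j)
  obtain rfl : (fun j => map (ultraMk U K) (p' j)) = p := _root_.funext hp'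
  obtain rfl : Ideal.span (Set.range fun j => map (ultraMk U K) (p' j)) = Q := hp
  let J : ∀ r, Ideal (MvPolynomial V (K r)) := fun r =>
    Ideal.span (Set.range fun j => coord K r (p' j))
  have hmem : ∀ y : ∀ r, MvPolynomial V (K r), ultraMk U _ y ∈
      (Ideal.span (Set.range fun j => map (ultraMk U K) (p' j))).map (internalize U K K V) ↔
      ∀ᶠ r in (U : Filter 𝕀), y r ∈ J r := fun y => ultraMk_mem_map_span_range_iff
  rw [hmem] at hxQ
  by_contra hx
  have hx' := hx
  rw [hmem, ← Ultrafilter.eventually_not] at hx'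
  -- The product of `a` with its largest internal power outside of `J` lies in `J`.
  have hM : ∀ r, ∃ M, a r ^ N r ∈ J r → a r ∉ J r → a r ^ M ∉ J r ∧ a r ^ M * a r ∈ J r := by
    classical
    intro r
    by_cases hr : a r ^ N r ∈ J r ∧ a r ∉ J r
    · have hex : ∃ k, a r ^ k ∈ J r := ⟨N r, hr.1⟩
      have h0 : Nat.find hex ≠ 0 := fun h0 => by
        have := Nat.find_spec hex
        rw [h0, pow_zero] at this
        exact hr.2 ((Ideal.eq_top_iff_one _).2 this ▸ Submodule.mem_top)
      obtain ⟨M, hM⟩ := Nat.exists_eq_succ_of_ne_zero h0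
      refine ⟨M, fun _ _ => ⟨Nat.find_min hex (by omega), ?_⟩⟩
      rw [← pow_succ, ← Nat.succ_eq_add_one, ← hM]
      exact Nat.find_spec hex
    · exact ⟨0, fun h₁ h₂ => absurd ⟨h₁, h₂⟩ hr⟩
  choose M hM using hM
  have hprod : ultraMk U (fun r => MvPolynomial V (K r)) (fun r => a r ^ M r) * ultraMk U _ a ∈
      (Ideal.span (Set.range fun j => map (ultraMk U K) (p' j))).map (internalize U K K V) := by
    rw [← map_mul, hmem]
    exact (hxQ.and hx').mono fun r hr => (hM r hr.1 hr.2).2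
  have h₁ := (hQ.mem_or_mem hprod).resolve_right hx
  rw [hmem] at h₁
  obtain ⟨r, h₂, h₃, h₄⟩ := (h₁.and (hxQ.and hx')).exists
  exact (hM r h₃ h₄).1 h₂

end PrimeExtension

end DeltaAlg

end

theorem proposition4p1 {𝕀 : Type*} (U : Ultrafilter 𝕀)
    (hU : ∀ r : 𝕀, U ≠ pure r) (m n : ℕ)
    (K : 𝕀 → Type*) [∀ r, Field (K r)] [∀ r, CharZero (K r)] [∀ r, DeltaAlg.DeltaRing m (K r)] :
    (DeltaAlg.unpack U m n K).FaithfullyFlat ∧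
      ∀ I : Ideal (DeltaAlg.DeltaPoly m n ((U : Filter 𝕀).Product K)),
        (I.IsPrime ↔ (I.map (DeltaAlg.unpack U m n K)).IsPrime) ∧
        {g : DeltaAlg.DeltaPoly m n ((U : Filter 𝕀).Product K) |
            ∃ N : (U : Filter 𝕀).Germ ℕ,
              DeltaAlg.ultraPow U (DeltaAlg.unpack U m n K g) N ∈
                I.map (DeltaAlg.unpack U m n K)} =
          (I.radical : Set (DeltaAlg.DeltaPoly m n ((U : Filter 𝕀).Product K))) := by
  have hφ := DeltaAlg.internalize_faithfullyFlat (U := U) (K := K) (DeltaAlg.ThetaX m n)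
  rw [DeltaAlg.unpack_eq_internalize]
  refine ⟨hφ, fun I => ⟨⟨fun h => DeltaAlg.isPrime_map_internalize I, fun h => ?_⟩, ?_⟩⟩
  · rw [← DeltaAlg.comap_map_of_faithfullyFlat hφ I]
    exact Ideal.comap_isPrime _ _
  · ext g
    rw [Set.mem_ofPred_eq, SetLike.mem_coe]
    constructor
    · rintro ⟨N, hN⟩
      rw [Ideal.radical_eq_sInf, Submodule.mem_sInf]
      rintro P ⟨hIP, hP⟩
      exact (DeltaAlg.map_mem_map_iff hφ).1
        (DeltaAlg.mem_map_of_ultraPow_mem_map P (Ideal.map_mono hIP hN))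
    · rintro ⟨k, hk⟩
      refine ⟨((fun _ => k : 𝕀 → ℕ) : (U : Filter 𝕀).Germ ℕ), ?_⟩
      have h := Ideal.mem_map_of_mem (DeltaAlg.internalize U K K (DeltaAlg.ThetaX m n)) hk
      rw [map_pow] at h
      obtain ⟨a, ha⟩ := DeltaAlg.ultraMk_surjective U _
        (DeltaAlg.internalize U K K (DeltaAlg.ThetaX m n) g)
      rw [← ha, ← map_pow] at h
      rw [← ha, DeltaAlg.ultraPow_ultraMk]
      exact h
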